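/- **Setting.** Let $A=(A^s)_{1\le s\le d}$ be complex $\chi\times\chi$ matrices forming an injective translation-invariant MPS tensor in left-canonical form: $\sum_s A^{s\dagger}A^s=\mathbb 1$, $\sum_s A^s\rho A^{s\dagger}=\rho$ for some positive definite $\rho$, the eigenvalue $1$ of the transfer matrix $\sum_s A^s\otimes (A^s)^*$ has a one-dimensional eigenspace, and all its other eigenvalues have modulus less than $1$. For $n\ge 1$ let $|\psi_n\rangle=\sum_{s_1,\dots,s_n}\mathrm{Tr}(A^{s_1}\cdots A^{s_n})|s_1\dots s_n\rangle$. Let $G$ be a (discrete) abelian group, $U:G\to U(d)$ an on-site unitary linear representation, $b\in\mathbb Z$ and $L\ge 1$ with $U_g^{\,b^L}=U_g$ for all $g$. The MPS has the exponential symmetry $\mathcal T(g)=g^b$ of period $L$ if for all $k\ge1$ and $g\in G$ the state $|\psi_{kL}\rangle$ satisfies $\bigotimes_{j=0}^{kL-1}U_g^{\,b^{j}}|\psi_{kL}\rangle=e^{i\theta}|\psi_{kL}\rangle$ for some phase $e^{i\theta}$ (depending on $k,g$). Virtual bond unitaries are unitary $\chi\times\chi$ matrices $v_j(g)$ ($j\ge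 0$, $g\in G$) such that, up to a phase independent of $s$, $\sum_{t}(U_g^{\,b^j})_{st}A^t \doteq v_j(g)^\dagger A^s v_{j+1}(g)$ for all $s$, and $v_j(g)v_j(h)=\omega_j(g,h)\,v_j(gh)$ with $\omega_j(g,h)\in U(1)$; $\omega_j$ is the virtual cocycle. **(1) Constraint.** For every injective MPS with exponential symmetry $\mathcal T(g)=g^b$ as above, virtual bond unitaries exist. For any choice of them, $v_{j+1}(g)\doteq v_j(g^b)$ up to a phase, each $\omega_j$ is a 2-cocycle, its class in $H^2(G,U(1))$ does not depend on $j$ or on the choice of the bond unitaries, and, up to coboundaries, $$\omega_j(g,h)=\omega_j(g^b,h^b)=\omega_j(g,h)^{b^2},\qquad\text{hence}\qquad \omega_j^{\,b^2-1}=1 .$$ **(2) Classification for $G=\mathbb Z_N\times\mathbb Z_N$.** Let $N\ge1$ and let $b$ be an integer coprime to $N$. Then there is $L\ge 1$ with $g^{b^L}=g$ for all $g\in G$. There is an isomorphism $H^2(G,U(1))\cong\mathbb Z_N$, $[\omega]\mapsto k$, where $k$ is determined by $\omega(g,h)\,\omega(h,g)^{-1}=e^{2\pi i k/N}$ with $g,h$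 the generators of the two factors. For every $L\ge1$ with $g^{b^L}=g$ for all $g\in G$, let the SPT phases be the classes in $H^2(G,U(1))$ carried by the virtual bonds of injective MPS with exponential symmetry $\mathcal T(g)=g^b$ of period $L$ and with $G$ represented linearly on each site. A class is an SPT phase if and only if its label $k$ is a multiple of $N/\gcd(b^2-1,N)$ in $\mathbb Z_N$; every such class is also realized with a faithful on-site representation. The SPT phases form a subgroup of $H^2(G,U(1))$ isomorphic to $\mathbb Z_{\gcd(b^2-1,N)}$. -/

import Mathlib

open scoped Matrix Kronecker ComplexOrder

universe u

noncomputable section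

namespace ExpSPT

/-! ### Matrix product states -/

/-- A translation-invariant MPS tensor: the same family of `χ × χ` matrices `A s`, labelled by the
on-site basis states `s`, is used on every site. -/
abbrev MPSTensor (d χ : ℕ) : Type := Fin d → Matrix (Fin χ) (Fin χ) ℂ

/-- The amplitudes `Tr (A^{s₁} ⋯ A^{sₙ})` of the MPS on a periodic chain of `n` sites. -/
def mpsState {d χ : ℕ} (A : MPSTensor d χ) (n : ℕ) : (Fin n → Fin d) → ℂ :=
  fun s => (List.ofFn fun i => A (s i)).prod.trace

/-- The transfer matrix `∑ₛ Aˢ ⊗ (Aˢ)^*` (`*` is entrywise complex conjugation). On a matrix `X`,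
seen as a vector indexed by pairs, it acts as `X ↦ ∑ₛ Aˢ X (Aˢ)ᴴ`. -/
def transferMatrix {d χ : ℕ} (A : MPSTensor d χ) :
    Matrix (Fin χ × Fin χ) (Fin χ × Fin χ) ℂ :=
  ∑ s, (A s) ⊗ₖ ((A s).map star)

/-- An injective MPS tensor in left-canonical form: the identity and a full-rank positive definite
`ρ` are the left and right dominant eigenvectors (eigenvalue `1`) of the transfer matrix, the
dominant eigenvector is unique, and all other eigenvalues have modulus less than `1`. -/
structure IsInjectiveMPS {d χ : ℕ} (A : MPSTensor d χ) : Prop where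
  left_canonical : ∑ s, (A s)ᴴ * A s = 1
  right_canonical : ∃ ρ : Matrix (Fin χ) (Fin χ) ℂ, ρ.PosDef ∧ ∑ s, A s * ρ * (A s)ᴴ = ρ
  unique_dominant :
    Module.finrank ℂ (Module.End.eigenspace (Matrix.toLin' (transferMatrix A)) (1 : ℂ)) = 1
  gap : ∀ μ : ℂ, Module.End.HasEigenvalue (Matrix.toLin' (transferMatrix A)) μ → μ ≠ 1 → ‖μ‖ < 1

/-! ### Exponential symmetries -/

/-- The tensor product operator `W₀ ⊗ W₁ ⊗ ⋯ ⊗ W_{n-1}` on a chain of `n` sites. -/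
def siteTensor {d : ℕ} (n : ℕ) (W : ℕ → Matrix (Fin d) (Fin d) ℂ) :
    Matrix (Fin n → Fin d) (Fin n → Fin d) ℂ :=
  Matrix.of fun s t => ∏ j : Fin n, W (j : ℕ) (s j) (t j)

/-- The on-site unitary of the group element `g` on site `j` (sites are counted from `0`):
`U_g ^ (b ^ j)`. -/
def onSite {G : Type*} [CommGroup G] {d : ℕ} (U : G →* Matrix.unitaryGroup (Fin d) ℂ) (b : ℤ)
    (g : G) (j : ℕ) : Matrix (Fin d) (Fin d) ℂ :=
  ((U g ^ (b ^ j) : Matrix.unitaryGroup (Fin d) ℂ) : Matrix (Fin d) (Fin d) ℂ)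

/-- The MPS of `A` has the exponential symmetry `⨂ⱼ U_g ^ (b ^ j)`, of period `L`: the symmetry
is compatible with the periodic chain of `L` sites, and for all `k ≥ 1` the MPS on `k L` sites is
an eigenstate of the `k`-fold periodic extension of the symmetry operator. -/
structure HasExpSymmetry {G : Type*} [CommGroup G] {d χ : ℕ} (A : MPSTensor d χ)
    (U : G →* Matrix.unitaryGroup (Fin d) ℂ) (b : ℤ) (L : ℕ) : Prop where
  periodic : ∀ g : G, U g ^ (b ^ L) = U g
  eigenstate : ∀ k : ℕ, 1 ≤ k → ∀ g : G, ∃ θ : Circle,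
    siteTensor (k * L) (onSite U b g) *ᵥ mpsState A (k * L) = (θ : ℂ) • mpsState A (k * L)

/-- The action `(W · A)ˢ = ∑ₜ W_{s t} Aᵗ` of an operator on the physical leg. -/
def physAct {d χ : ℕ} (W : Matrix (Fin d) (Fin d) ℂ) (A : MPSTensor d χ) : MPSTensor d χ :=
  fun s => ∑ t, W s t • A t

/-- `v` is a family of virtual bond unitaries for the exponential symmetry, with (virtual) factor
system `ω j` on bond `j`: site `j` lies between the bonds `j` and `j + 1`, the symmetry is pushed
through the tensor on site `j`, up to a phase, to `v_j(g)ᴴ` and `v_{j+1}(g)`, and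
`v_j(g) v_j(h) = ω_j(g,h) v_j(g h)`. -/
structure IsVirtualRep {G : Type*} [CommGroup G] {d χ : ℕ} (A : MPSTensor d χ)
    (U : G →* Matrix.unitaryGroup (Fin d) ℂ) (b : ℤ)
    (v : ℕ → G → Matrix.unitaryGroup (Fin χ) ℂ) (ω : ℕ → G → G → Circle) : Prop where
  push_through : ∀ (j : ℕ) (g : G), ∃ φ : Circle, ∀ s : Fin d,
    physAct (onSite U b g j) A s =
      (φ : ℂ) • ((v j g : Matrix (Fin χ) (Fin χ) ℂ)ᴴ * A s *
        (v (j + 1) g : Matrix (Fin χ) (Fin χ) ℂ))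
  projective : ∀ (j : ℕ) (g h : G),
    (v j g : Matrix (Fin χ) (Fin χ) ℂ) * (v j h : Matrix (Fin χ) (Fin χ) ℂ) =
      (ω j g h : ℂ) • (v j (g * h) : Matrix (Fin χ) (Fin χ) ℂ)

/-! ### Cocycles with values in `U(1)` -/

/-- `ω` is a `U(1)`-valued 2-cocycle (trivial action). -/
def IsTwoCocycle {G : Type*} [CommGroup G] (ω : G → G → Circle) : Prop :=
  ∀ g h l : G, ω g h * ω (g * h) l = ω h l * ω g (h * l)

/-- `ω = 1` up to coboundaries. -/
def IsTwoCoboundary {G : Type*} [CommGroup G] (ω : G → G → Circle) : Prop :=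
  ∃ β : G → Circle, ∀ g h : G, ω g h = β g * β h / β (g * h)

/-- `ω = ω'` up to coboundaries. -/
def Cohomologous {G : Type*} [CommGroup G] (ω ω' : G → G → Circle) : Prop :=
  IsTwoCoboundary fun g h => ω g h / ω' g h

/-- `U(1)` with trivial `G`-action, written additively. -/
abbrev u1Rep (G : Type) [CommGroup G] : Rep ℤ G := Rep.trivial ℤ G (Additive Circle)

/-- The group cohomology `H²(G, U(1))`. -/
abbrev H2U1 (G : Type) [CommGroup G] := groupCohomology.H2 (u1Rep G)

/-- The value at `(g, h)` of a `U(1)`-valued 2-cocycle, as a complex number of modulus one. -/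
def cocycleVal {G : Type} [CommGroup G] (x : groupCohomology.cocycles₂ (u1Rep G)) (g h : G) :
    Circle :=
  Additive.toMul (α := Circle) (x (g, h))

/-- The virtual bonds of the MPS of `A` carry the projective class `c ∈ H²(G, U(1))`. -/
def CarriesClass {G : Type} [CommGroup G] {d χ : ℕ} (A : MPSTensor d χ)
    (U : G →* Matrix.unitaryGroup (Fin d) ℂ) (b : ℤ) (c : H2U1 G) : Prop :=
  ∃ (v : ℕ → G → Matrix.unitaryGroup (Fin χ) ℂ) (ω : ℕ → G → G → Circle)
    (x : groupCohomology.cocycles₂ (u1Rep G)),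
    IsVirtualRep A U b v ω ∧ (∀ g h : G, cocycleVal x g h = ω 0 g h) ∧
      groupCohomology.H2π (u1Rep G) x = c

/-- The SPT phases protected by the exponential symmetry `T(g) = g ^ b` of period `L`, with
on-site group `G` represented linearly on every site: the projective classes carried by the
virtual bonds of translation-invariant injective MPS with this symmetry. -/
def sptPhases (G : Type) [CommGroup G] (b : ℤ) (L : ℕ) : Set (H2U1 G) :=
  {c | ∃ (d χ : ℕ) (A : MPSTensor d χ) (U : G →* Matrix.unitaryGroup (Fin d) ℂ),
    IsInjectiveMPS A ∧ HasExpSymmetry A U b L ∧ CarriesClass A U b c}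

/-- The group `ℤ_N × ℤ_N`, written multiplicatively. -/
abbrev ZN2 (N : ℕ) : Type := Multiplicative (ZMod N) × Multiplicative (ZMod N)

/-- The generator of the first factor of `ℤ_N × ℤ_N`. -/
def gen₁ (N : ℕ) : ZN2 N := (Multiplicative.ofAdd 1, 1)

/-- The generator of the second factor of `ℤ_N × ℤ_N`. -/
def gen₂ (N : ℕ) : ZN2 N := (1, Multiplicative.ofAdd 1)

end ExpSPT

end

/-!
A projective symmetry is read off from the state through a spectral gap. If the states of `A` and of
`U · A` on `k L` sites agree up to a phase for every `k`, then the traces of the powers of the mixed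
transfer matrix over one period have modulus tending to `1`, so that matrix has an eigenvalue of
modulus at least `1`. In the norm weighted by the fixed point `ρ` the mixed transfer map is a
contraction, and equality forces an intertwiner: its eigenvector is a unitary gauge transformation
from `A` to `U · A`, unique up to a phase because `1` is a simple eigenvalue of the transfer matrix.

Moving along the chain by one site replaces `g` by `g ^ b`, so `v (j + 1) g` agrees with
`v j (g ^ b)` up to a phase. On a linear on-site representation the cocycles of the two bonds next
to a site must cancel, so `[ω]` equals its pullback along `g ↦ g ^ b`. The class of a cocycle of an
abelian group is determined by its commutator pairing, because `U(1)` is divisible, and this pairing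
is bilinear, so the pullback is `b² [ω]`. Conversely, if `(b² - 1) [ω] = 0`, the fixed-point tensor
whose two physical legs carry the conjugate of `V g` and `V (g ^ b)`, with `V` the regular
representation twisted by `ω`, carries the class `[ω]`.
-/

noncomputable section

namespace ExpSPT

open Filter Module Topology

/-! ### Powers of matrices with a spectral gap -/

theorem tendsto_pow_zero_of_spectralRadius_lt_one {R : Type*} [NormedRing R] [NormedAlgebra ℂ R]
    [CompleteSpace R] {a : R} (ha : spectralRadius ℂ a < 1) :
    Tendsto (fun n : ℕ => a ^ n) atTop (𝓝 0) := by
  obtain ⟨r, har, hr⟩ := ENNReal.lt_iff_exists_nnreal_btwn.1 ha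
  refine squeeze_zero_norm' ?_ (tendsto_pow_atTop_nhds_zero_of_lt_one r.2 (mod_cast hr))
  have hroot := spectrum.pow_nnnorm_pow_one_div_tendsto_nhds_spectralRadius a
  filter_upwards [hroot.eventually_lt_const har, eventually_ne_atTop 0] with n hn hn0
  have h := ENNReal.rpow_le_rpow hn.le n.cast_nonneg
  rw [← ENNReal.rpow_mul, one_div_mul_cancel (mod_cast hn0), ENNReal.rpow_one,
    ENNReal.rpow_natCast] at h
  exact_mod_cast h

section SpectralGap

variable {n : Type*} [Fintype n] [DecidableEq n] {M : Matrix n n ℂ}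

theorem tendsto_matrix_pow_zero (hM : ∀ μ, End.HasEigenvalue (Matrix.toLin' M) μ → ‖μ‖ < 1) :
    Tendsto (fun k : ℕ => M ^ k) atTop (𝓝 0) := by
  let _ : NormedRing (Matrix n n ℂ) := Matrix.linftyOpNormedRing
  let _ : NormedAlgebra ℂ (Matrix n n ℂ) := Matrix.linftyOpNormedAlgebra
  cases isEmpty_or_nonempty n
  · exact tendsto_const_nhds.congr fun k => Subsingleton.elim 0 (M ^ k)
  · refine tendsto_pow_zero_of_spectralRadius_lt_one
      (spectrum.spectralRadius_lt_of_forall_lt (r := 1) M fun μ hμ => ?_)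
    rw [← Matrix.spectrum_toLin', ← End.hasEigenvalue_iff_mem_spectrum] at hμ
    exact hM μ hμ

theorem one_le_norm_of_tendsto_norm_trace_pow
    (hM : Tendsto (fun k : ℕ => ‖(M ^ k).trace‖) atTop (𝓝 1)) :
    ∃ μ, End.HasEigenvalue (Matrix.toLin' M) μ ∧ 1 ≤ ‖μ‖ := by
  by_contra! h
  have htrace : Tendsto (fun k : ℕ => ‖(M ^ k).trace‖) atTop (𝓝 ‖(0 : Matrix n n ℂ).trace‖) :=
    ((continuous_id.matrix_trace.norm).tendsto _).comp (tendsto_matrix_pow_zero h)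
  simpa using tendsto_nhds_unique hM htrace

variable {x y : n → ℂ}

theorem sub_vecMulVec_pow_succ (hx : M *ᵥ x = x) (hy : y ᵥ* M = y) (hyx : y ⬝ᵥ x = 1) (k : ℕ) :
    (M - Matrix.vecMulVec x y) ^ (k + 1) = M ^ (k + 1) - Matrix.vecMulVec x y := by
  have hpow : ∀ m : ℕ, M ^ m *ᵥ x = x := fun m => by
    induction m with
    | zero => simp
    | succ m ih => rw [pow_succ, ← Matrix.mulVec_mulVec, hx, ih]
  induction k with
  | zero => simp
  | succ k ih =>
    rw [pow_succ, ih, sub_mul, mul_sub, mul_sub, ← pow_succ, Matrix.mul_vecMulVec, hpow,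
      Matrix.vecMulVec_mul, hy, Matrix.vecMulVec_mul_vecMulVec, hyx, one_smul, sub_self, sub_zero]

theorem norm_lt_one_of_hasEigenvalue_sub_vecMulVec (hx : M *ᵥ x = x) (hy : y ᵥ* M = y)
    (hyx : y ⬝ᵥ x = 1) (h1 : finrank ℂ (End.eigenspace (Matrix.toLin' M) 1) = 1)
    (hgap : ∀ μ, End.HasEigenvalue (Matrix.toLin' M) μ → μ ≠ 1 → ‖μ‖ < 1) {μ : ℂ}
    (hμ : End.HasEigenvalue (Matrix.toLin' (M - Matrix.vecMulVec x y)) μ) : ‖μ‖ < 1 := by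
  obtain ⟨v, hv, hv0⟩ := hμ.exists_hasEigenvector
  rw [End.mem_eigenspace_iff, Matrix.toLin'_apply] at hv
  have hμyv : μ * (y ⬝ᵥ v) = 0 := by
    rw [← smul_eq_mul, ← dotProduct_smul, ← hv, Matrix.dotProduct_mulVec, Matrix.vecMul_sub, hy,
      Matrix.vecMul_vecMulVec, hyx, one_smul, sub_self, zero_dotProduct]
  rcases mul_eq_zero.1 hμyv with rfl | hyv
  · simp
  have hMv : M *ᵥ v = μ • v := by
    rw [← hv, Matrix.sub_mulVec, Matrix.vecMulVec_mulVec, hyv]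
    simp
  have hvμ : v ∈ End.eigenspace (Matrix.toLin' M) μ := End.mem_eigenspace_iff.2 hMv
  refine hgap μ (End.hasEigenvalue_of_hasEigenvector ⟨hvμ, hv0⟩) ?_
  rintro rfl
  have hx1 : x ∈ End.eigenspace (Matrix.toLin' M) 1 := End.mem_eigenspace_iff.2 (by simpa using hx)
  have hx0 : x ≠ 0 := by rintro rfl; simp at hyx
  obtain ⟨c, hc⟩ := (finrank_eq_one_iff_of_nonzero' (⟨x, hx1⟩ : End.eigenspace _ _)
    (Subtype.coe_ne_coe.1 hx0)).1 h1 ⟨v, hvμ⟩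
  obtain rfl : c • x = v := congrArg Subtype.val hc
  rw [dotProduct_smul, hyx, smul_eq_mul, mul_one] at hyv
  exact hv0 (by rw [hyv, zero_smul])

theorem tendsto_matrix_pow_vecMulVec (hx : M *ᵥ x = x) (hy : y ᵥ* M = y) (hyx : y ⬝ᵥ x = 1)
    (h1 : finrank ℂ (End.eigenspace (Matrix.toLin' M) 1) = 1)
    (hgap : ∀ μ, End.HasEigenvalue (Matrix.toLin' M) μ → μ ≠ 1 → ‖μ‖ < 1) :
    Tendsto (fun k : ℕ => M ^ k) atTop (𝓝 (Matrix.vecMulVec x y)) := by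
  rw [← tendsto_add_atTop_iff_nat 1]
  have h := (tendsto_add_atTop_iff_nat 1).2 <| tendsto_matrix_pow_zero fun μ hμ =>
    norm_lt_one_of_hasEigenvalue_sub_vecMulVec hx hy hyx h1 hgap hμ
  simpa [sub_vecMulVec_pow_succ hx hy hyx] using h.add_const (Matrix.vecMulVec x y)

end SpectralGap

/-! ### Chains of tensors and mixed transfer matrices -/

/-- Equality up to a phase, the relation `≐` of the paper. -/
def PhaseEq {E : Type*} [SMul ℂ E] (x y : E) : Prop :=
  ∃ θ : Circle, x = (θ : ℂ) • y

section PhaseEq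

variable {E : Type*} [MulAction ℂ E] {x y z : E}

theorem PhaseEq.symm : PhaseEq x y → PhaseEq y x := by
  rintro ⟨θ, rfl⟩
  exact ⟨θ⁻¹, by rw [smul_smul, ← Circle.coe_mul, inv_mul_cancel, Circle.coe_one, one_smul]⟩

theorem PhaseEq.trans : PhaseEq x y → PhaseEq y z → PhaseEq x z := by
  rintro ⟨θ, rfl⟩ ⟨η, rfl⟩
  exact ⟨θ * η, by rw [smul_smul, Circle.coe_mul]⟩

theorem PhaseEq.map {E F : Type*} [AddCommMonoid E] [AddCommMonoid F] [Module ℂ E] [Module ℂ F]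
    {x y : E} (h : PhaseEq x y) (f : E →ₗ[ℂ] F) : PhaseEq (f x) (f y) := by
  obtain ⟨θ, rfl⟩ := h
  exact ⟨θ, map_smul f _ _⟩

end PhaseEq

section ListProducts

theorem prod_ofFn_sum {R ι : Type*} [Semiring R] [Fintype ι] {n : ℕ} (M : Fin n → ι → R) :
    (List.ofFn fun i => ∑ s, M i s).prod =
      ∑ s : Fin n → ι, (List.ofFn fun i => M i (s i)).prod := by
  induction n with
  | zero => simp
  | succ n ih =>
    rw [List.ofFn_succ, List.prod_cons, ih, ← (Fin.consEquiv fun _ => ι).sum_comp,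
      Fintype.sum_prod_type, Finset.sum_mul_sum]
    simp [Fin.consEquiv, List.ofFn_succ]

theorem prod_ofFn_smul {S R : Type*} [CommSemiring S] [Semiring R] [Algebra S R] {n : ℕ}
    (c : Fin n → S) (M : Fin n → R) :
    (List.ofFn fun i => c i • M i).prod = (∏ i, c i) • (List.ofFn M).prod := by
  induction n with
  | zero => simp
  | succ n ih => simp [List.ofFn_succ, ih, Fin.prod_univ_succ, smul_smul, mul_comm]

theorem prod_ofFn_periodic {M : Type*} [Monoid M] {X : ℕ → M} {L : ℕ}
    (hX : Function.Periodic X L) (k : ℕ) :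
    (List.ofFn fun i : Fin (k * L) => X i).prod = (List.ofFn fun i : Fin L => X i).prod ^ k := by
  have hshift (i j : ℕ) : X (i * L + j) = X j := by rw [add_comm]; exact hX.nat_mul i j
  simp only [List.ofFn_mul, hshift, List.ofFn_const, List.prod_flatten, List.map_replicate,
    List.prod_replicate]

theorem prod_ofFn_kronecker {S m n : Type*} [CommSemiring S] [Fintype m] [DecidableEq m] [Fintype n]
    [DecidableEq n] {N : ℕ} (P : Fin N → Matrix m m S) (Q : Fin N → Matrix n n S) :
    (List.ofFn fun i => P i ⊗ₖ Q i).prod = (List.ofFn P).prod ⊗ₖ (List.ofFn Q).prod := by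
  induction N with
  | zero => simp
  | succ N ih => simp [List.ofFn_succ, ih, Matrix.mul_kronecker_mul]

end ListProducts

section Chains

variable {d χ : ℕ}

/-- The amplitudes `Tr (B₀^{s₀} ⋯ B_{n-1}^{s_{n-1}})` of a matrix product state on a periodic chain
whose tensor `B j` depends on the site `j`. -/
def chainState (B : ℕ → MPSTensor d χ) (n : ℕ) : (Fin n → Fin d) → ℂ :=
  fun s => (List.ofFn fun i => B i (s i)).prod.trace

theorem siteTensor_mulVec_mpsState (A : MPSTensor d χ) (n : ℕ)
    (W : ℕ → Matrix (Fin d) (Fin d) ℂ) :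
    siteTensor n W *ᵥ mpsState A n = chainState (fun j => physAct (W j) A) n := by
  ext s
  simp only [chainState, physAct, prod_ofFn_sum, prod_ofFn_smul, Matrix.trace_sum,
    Matrix.trace_smul, Matrix.mulVec, dotProduct, siteTensor, mpsState, Matrix.of_apply,
    smul_eq_mul]

/-- The mixed transfer matrix `∑ₛ Bˢ ⊗ (Aˢ)^*` of two tensors. -/
def mixedTransfer (B A : MPSTensor d χ) : Matrix (Fin χ × Fin χ) (Fin χ × Fin χ) ℂ :=
  ∑ s, B s ⊗ₖ (A s).map star

theorem chainState_dotProduct_star (B A : ℕ → MPSTensor d χ) (n : ℕ) :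
    chainState B n ⬝ᵥ star (chainState A n) =
      (List.ofFn fun i : Fin n => mixedTransfer (B i) (A i)).prod.trace := by
  have hstar (s : Fin n → Fin d) :
      star (chainState A n s) = (List.ofFn fun i : Fin n => (A i (s i)).map star).prod.trace := by
    rw [chainState, ← starRingEnd_apply, AddMonoidHom.map_trace]
    have h := map_list_prod (starRingEnd ℂ).mapMatrix (List.ofFn fun i : Fin n => A i (s i))
    rw [List.map_ofFn] at h
    exact congrArg Matrix.trace h
  simp only [dotProduct, Pi.star_apply, hstar]
  simp only [chainState, mixedTransfer, prod_ofFn_sum, prod_ofFn_kronecker, Matrix.trace_sum,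
    Matrix.trace_kronecker]

theorem norm_trace_mixedTransfer_pow {A : MPSTensor d χ} {B : ℕ → MPSTensor d χ} {L k : ℕ}
    (hB : Function.Periodic B L) (h : PhaseEq (chainState B (k * L)) (mpsState A (k * L))) :
    ‖((List.ofFn fun i : Fin L => mixedTransfer (B i) A).prod ^ k).trace‖ =
      ‖(transferMatrix A ^ (k * L)).trace‖ := by
  have hBA := chainState_dotProduct_star B (fun _ => A) (k * L)
  have hAA := chainState_dotProduct_star (fun _ => A) (fun _ => A) (k * L)
  rw [prod_ofFn_periodic (X := fun i => mixedTransfer (B i) A)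
    (hB.comp fun C => mixedTransfer C A)] at hBA
  rw [List.ofFn_const, List.prod_replicate] at hAA
  obtain ⟨θ, hθ⟩ := h
  rw [← hBA, hθ, smul_dotProduct, smul_eq_mul, norm_mul, Circle.norm_coe, one_mul]
  exact congrArg norm hAA

/-- The map `X ↦ ∑ₛ (Bˢ)ᴴ X Aˢ`, which is the action of the adjoint of
`mixedTransfer B A` on matrices. -/
def mixedMap (B A : MPSTensor d χ) : End ℂ (Matrix (Fin χ) (Fin χ) ℂ) :=
  ∑ s, LinearMap.mulLeft ℂ (B s)ᴴ ∘ₗ LinearMap.mulRight ℂ (A s)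

theorem mixedMap_apply (B A : MPSTensor d χ) (X : Matrix (Fin χ) (Fin χ) ℂ) :
    mixedMap B A X = ∑ s, (B s)ᴴ * X * A s := by
  simp [mixedMap, Matrix.mul_assoc]

theorem mixedTransfer_conjTranspose_mulVec_vec (B A : MPSTensor d χ)
    (X : Matrix (Fin χ) (Fin χ) ℂ) :
    (mixedTransfer B A)ᴴ *ᵥ Matrix.vec Xᵀ = Matrix.vec (mixedMap B A X)ᵀ := by
  have hconj (P : Matrix (Fin χ) (Fin χ) ℂ) : (P.map star)ᴴ = Pᵀ := by ext; simp
  simp only [mixedTransfer, Matrix.conjTranspose_sum, Matrix.sum_mulVec,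
    Matrix.conjTranspose_kronecker, hconj, Matrix.kronecker_mulVec_vec, mixedMap_apply,
    Matrix.transpose_sum, Matrix.transpose_mul, Matrix.vec_sum, Matrix.mul_assoc]

theorem transferMatrix_mulVec_vec (A : MPSTensor d χ) (X : Matrix (Fin χ) (Fin χ) ℂ) :
    transferMatrix A *ᵥ Matrix.vec Xᵀ = Matrix.vec (∑ s, A s * X * (A s)ᴴ)ᵀ := by
  simp only [transferMatrix, Matrix.sum_mulVec, Matrix.kronecker_mulVec_vec, Matrix.transpose_sum,
    Matrix.transpose_mul, Matrix.vec_sum, Matrix.mul_assoc]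
  rfl

end Chains

/-! ### The stationary state of an injective tensor -/

section Stationary

variable {d χ : ℕ} {A : MPSTensor d χ}

theorem IsInjectiveMPS.nonempty_bond (hA : IsInjectiveMPS A) : Nonempty (Fin χ) := by
  by_contra h
  rw [not_nonempty_iff] at h
  have := hA.unique_dominant
  rw [finrank_zero_of_subsingleton] at this
  exact zero_ne_one this

theorem IsInjectiveMPS.exists_stationary_state (hA : IsInjectiveMPS A) :
    ∃ ρ : Matrix (Fin χ) (Fin χ) ℂ, ρ.PosDef ∧ ρ.trace = 1 ∧ ∑ s, A s * ρ * (A s)ᴴ = ρ := by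
  obtain ⟨ρ, hρ, hfix⟩ := hA.right_canonical
  have := hA.nonempty_bond
  have htr : 0 < ρ.trace := hρ.trace_pos
  refine ⟨ρ.trace⁻¹ • ρ, hρ.smul (RCLike.inv_pos_of_pos htr), ?_, ?_⟩
  · rw [Matrix.trace_smul, smul_eq_mul, inv_mul_cancel₀ htr.ne']
  · simp only [Matrix.mul_smul, Matrix.smul_mul, ← Finset.smul_sum, hfix]

variable {ρ : Matrix (Fin χ) (Fin χ) ℂ}

theorem IsInjectiveMPS.tendsto_transferMatrix_pow (hA : IsInjectiveMPS A) (htr : ρ.trace = 1)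
    (hfix : ∑ s, A s * ρ * (A s)ᴴ = ρ) :
    Tendsto (fun n : ℕ => transferMatrix A ^ n) atTop
      (𝓝 (Matrix.vecMulVec (Matrix.vec ρᵀ) (Matrix.vec 1))) := by
  refine tendsto_matrix_pow_vecMulVec ?_ ?_ ?_ hA.unique_dominant hA.gap
  · rw [transferMatrix_mulVec_vec, hfix]
  · simp only [transferMatrix, Matrix.vecMul_sum, Matrix.vec_vecMul_kronecker, Matrix.mul_one,
      ← Matrix.vec_sum]
    exact congrArg Matrix.vec hA.left_canonical
  · rw [Matrix.vec_dotProduct_vec, Matrix.transpose_one, Matrix.one_mul, Matrix.trace_transpose,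
      htr]

theorem IsInjectiveMPS.tendsto_norm_trace_transferMatrix_pow (hA : IsInjectiveMPS A) :
    Tendsto (fun n : ℕ => ‖(transferMatrix A ^ n).trace‖) atTop (𝓝 1) := by
  obtain ⟨ρ, -, htr, hfix⟩ := hA.exists_stationary_state
  have h := ((continuous_id.matrix_trace.norm).tendsto _).comp
    (hA.tendsto_transferMatrix_pow htr hfix)
  rwa [id, Matrix.trace_vecMulVec, Matrix.vec_dotProduct_vec, Matrix.mul_one,
    Matrix.transpose_transpose, htr, norm_one] at h

theorem transferMatrix_conjTranspose_pow_mulVec_vec (A : MPSTensor d χ)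
    (X : Matrix (Fin χ) (Fin χ) ℂ) (n : ℕ) :
    (transferMatrix A ^ n)ᴴ *ᵥ Matrix.vec Xᵀ = Matrix.vec ((mixedMap A A ^ n) X)ᵀ := by
  induction n with
  | zero => simp
  | succ n ih =>
    rw [pow_succ, Matrix.conjTranspose_mul, ← Matrix.mulVec_mulVec, ih, pow_succ']
    exact mixedTransfer_conjTranspose_mulVec_vec A A _

theorem IsInjectiveMPS.tendsto_mixedMap_pow (hA : IsInjectiveMPS A) (hρ : ρ.IsHermitian)
    (htr : ρ.trace = 1) (hfix : ∑ s, A s * ρ * (A s)ᴴ = ρ) (X : Matrix (Fin χ) (Fin χ) ℂ) :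
    Tendsto (fun n : ℕ => (mixedMap A A ^ n) X) atTop (𝓝 ((X * ρ).trace • 1)) := by
  have hlim : (Matrix.vecMulVec (Matrix.vec ρᵀ) (Matrix.vec 1))ᴴ *ᵥ Matrix.vec Xᵀ =
      Matrix.vec ((X * ρ).trace • (1 : Matrix (Fin χ) (Fin χ) ℂ))ᵀ := by
    have hstar : star (Matrix.vec ρᵀ) = Matrix.vec ρ := congrArg Matrix.vec hρ
    have hone : star (Matrix.vec (1 : Matrix (Fin χ) (Fin χ) ℂ)) = Matrix.vec 1 :=
      congrArg Matrix.vec (Matrix.map_one star (star_zero ℂ) (star_one ℂ))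
    rw [Matrix.conjTranspose_vecMulVec, hstar, hone, Matrix.vecMulVec_mulVec,
      Matrix.vec_dotProduct_vec, ← Matrix.transpose_mul, Matrix.trace_transpose,
      Matrix.transpose_smul, Matrix.transpose_one, Matrix.vec_smul, op_smul_eq_smul]
  have hvec : Tendsto (fun n : ℕ => Matrix.vec ((mixedMap A A ^ n) X)ᵀ) atTop
      (𝓝 (Matrix.vec ((X * ρ).trace • (1 : Matrix (Fin χ) (Fin χ) ℂ))ᵀ)) := by
    simp only [← hlim, ← transferMatrix_conjTranspose_pow_mulVec_vec]
    exact ((continuous_id.matrix_conjTranspose.matrix_mulVec continuous_const).tendsto _).comp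
      (hA.tendsto_transferMatrix_pow htr hfix)
  exact tendsto_pi_nhds.2 fun i => tendsto_pi_nhds.2 fun j => tendsto_pi_nhds.1 hvec (i, j)

end Stationary

/-! ### The contraction property of mixed maps -/

/-- The squared norm `Tr (X ρ Xᴴ)` of `X` in the GNS inner product of a state `ρ`. -/
def wnorm {m n : Type*} [Fintype m] [Fintype n] (ρ : Matrix n n ℂ) (X : Matrix m n ℂ) : ℝ :=
  (X * ρ * Xᴴ).trace.re

section Wnorm

variable {m n : Type*} [Fintype m] [Fintype n] {ρ : Matrix n n ℂ}

theorem wnorm_eq_sum_dotProduct (X : Matrix m n ℂ) :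
    wnorm ρ X = ∑ i, (X i ⬝ᵥ ρ *ᵥ star (X i)).re := by
  simp only [wnorm, Matrix.trace, Matrix.diag, Complex.re_sum, Matrix.mul_assoc]
  rfl

theorem wnorm_nonneg (hρ : ρ.PosSemidef) (X : Matrix m n ℂ) : 0 ≤ wnorm ρ X :=
  (Complex.nonneg_iff.1 (hρ.mul_mul_conjTranspose_same X).trace_nonneg).1

theorem wnorm_eq_zero_iff (hρ : ρ.PosDef) {X : Matrix m n ℂ} : wnorm ρ X = 0 ↔ X = 0 := by
  refine ⟨fun h => ?_, by rintro rfl; simp [wnorm]⟩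
  have hrow (x : n → ℂ) : 0 ≤ (x ⬝ᵥ ρ *ᵥ star x).re := by
    simpa using (Complex.nonneg_iff.1 (hρ.posSemidef.dotProduct_mulVec_nonneg (star x))).1
  rw [wnorm_eq_sum_dotProduct, Finset.sum_eq_zero_iff_of_nonneg fun i _ => hrow (X i)] at h
  refine funext fun i => ?_
  by_contra hi
  have hpos := hρ.dotProduct_mulVec_pos (star_ne_zero.2 (hi : X i ≠ 0))
  rw [star_star] at hpos
  exact (Complex.pos_iff.1 hpos).1.ne' (h i (Finset.mem_univ i))

theorem wnorm_smul (c : ℂ) (X : Matrix m n ℂ) : wnorm ρ (c • X) = ‖c‖ ^ 2 * wnorm ρ X := by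
  simp only [wnorm, Matrix.conjTranspose_smul, Matrix.smul_mul, Matrix.mul_smul, smul_smul,
    Matrix.trace_smul, smul_eq_mul]
  rw [mul_comm (star c), Complex.star_def, Complex.mul_conj', ← Complex.ofReal_pow,
    Complex.re_ofReal_mul]

theorem coe_wnorm (hρ : ρ.PosSemidef) (X : Matrix m n ℂ) :
    (wnorm ρ X : ℂ) = (X * ρ * Xᴴ).trace :=
  (Complex.eq_re_of_ofReal_le (hρ.mul_mul_conjTranspose_same X).trace_nonneg).symm

theorem exists_wnorm_smul_eq_one (hρ : ρ.PosDef) {X : Matrix m n ℂ} (hX : X ≠ 0) :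
    ∃ c : ℂ, wnorm ρ (c • X) = 1 := by
  have hpos : 0 < wnorm ρ X := (wnorm_nonneg hρ.posSemidef X).lt_of_ne' fun h =>
    hX ((wnorm_eq_zero_iff hρ).1 h)
  refine ⟨(√(wnorm ρ X))⁻¹, ?_⟩
  rw [wnorm_smul, norm_inv, Complex.norm_real, Real.norm_of_nonneg (Real.sqrt_nonneg _), inv_pow,
    Real.sq_sqrt hpos.le, inv_mul_cancel₀ hpos.ne']

theorem PhaseEq.wnorm_eq {X Y : Matrix m n ℂ} (h : PhaseEq X Y) : wnorm ρ X = wnorm ρ Y := by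
  obtain ⟨θ, rfl⟩ := h
  rw [wnorm_smul, Circle.norm_coe, one_pow, one_mul]

theorem wnorm_one [DecidableEq n] (htr : ρ.trace = 1) : wnorm ρ (1 : Matrix n n ℂ) = 1 := by
  simp [wnorm, htr]

theorem wnorm_of_mem_unitaryGroup [DecidableEq n] (htr : ρ.trace = 1) {X : Matrix n n ℂ}
    (hX : X ∈ Matrix.unitaryGroup n ℂ) : wnorm ρ X = 1 := by
  rw [wnorm, Matrix.trace_mul_comm, ← Matrix.mul_assoc, ← Matrix.star_eq_conjTranspose,
    Matrix.mem_unitaryGroup_iff'.1 hX, Matrix.one_mul, htr, Complex.one_re]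

theorem continuous_wnorm : Continuous (wnorm ρ : Matrix m n ℂ → ℝ) :=
  Complex.continuous_re.comp ((continuous_id.matrix_mul continuous_const).matrix_mul
    continuous_id.matrix_conjTranspose).matrix_trace

theorem wnorm_sub (hρ : ρ.IsHermitian) (X Y : Matrix m n ℂ) :
    wnorm ρ (X - Y) = wnorm ρ X - 2 * (X * ρ * Yᴴ).trace.re + wnorm ρ Y := by
  have hYX : (Y * ρ * Xᴴ).trace.re = (X * ρ * Yᴴ).trace.re := by
    rw [← Complex.conj_re, ← Complex.star_def, ← Matrix.trace_conjTranspose]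
    simp [hρ.eq, Matrix.mul_assoc]
  simp only [wnorm, Matrix.conjTranspose_sub, Matrix.sub_mul, Matrix.mul_sub, Matrix.trace_sub,
    Complex.sub_re, hYX]
  ring

theorem wnorm_sub_trace_smul_one [DecidableEq n] (hρ : ρ.IsHermitian) (htr : ρ.trace = 1)
    (X : Matrix n n ℂ) :
    wnorm ρ (X - (X * ρ).trace • 1) = wnorm ρ X - ‖(X * ρ).trace‖ ^ 2 := by
  rw [wnorm_sub hρ, wnorm_smul, wnorm_one htr, Matrix.conjTranspose_smul, Matrix.conjTranspose_one,
    Matrix.mul_smul, Matrix.mul_one, Matrix.trace_smul, smul_eq_mul, Complex.star_def,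
    Complex.conj_mul', ← Complex.ofReal_pow, Complex.ofReal_re]
  ring

end Wnorm

section Contraction

variable {d χ : ℕ} {A B : MPSTensor d χ} {ρ : Matrix (Fin χ) (Fin χ) ℂ}

theorem sum_wnorm_mul_tensor (hfix : ∑ s, A s * ρ * (A s)ᴴ = ρ) (Y : Matrix (Fin χ) (Fin χ) ℂ) :
    ∑ s, wnorm ρ (Y * A s) = wnorm ρ Y := by
  have hsum : ∑ s, Y * A s * ρ * (Y * A s)ᴴ = Y * ρ * Yᴴ := by
    nth_rw 2 [← hfix]
    simp only [Matrix.conjTranspose_mul, Matrix.mul_sum, Matrix.sum_mul, Matrix.mul_assoc]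
  simp only [wnorm, ← Complex.re_sum, ← Matrix.trace_sum, hsum]

theorem sum_wnorm_tensor_mul (hB : ∑ s, (B s)ᴴ * B s = 1) (Z : Matrix (Fin χ) (Fin χ) ℂ) :
    ∑ s, wnorm ρ (B s * Z) = wnorm ρ Z := by
  have hcyc (s : Fin d) :
      (B s * Z * ρ * (B s * Z)ᴴ).trace = ((B s)ᴴ * B s * (Z * ρ * Zᴴ)).trace := by
    rw [Matrix.conjTranspose_mul, ← Matrix.mul_assoc, Matrix.trace_mul_comm]
    simp only [Matrix.mul_assoc]
  simp only [wnorm, hcyc, ← Complex.re_sum, ← Matrix.trace_sum, ← Matrix.sum_mul, hB,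
    Matrix.one_mul]

theorem sum_trace_mul_tensor_tensor_mul (Y Z : Matrix (Fin χ) (Fin χ) ℂ) :
    ∑ s, (Y * A s * ρ * (B s * Z)ᴴ).trace = (mixedMap B A Y * ρ * Zᴴ).trace := by
  have hcyc (s : Fin d) : (Y * A s * ρ * (B s * Z)ᴴ).trace = ((B s)ᴴ * Y * A s * ρ * Zᴴ).trace := by
    rw [Matrix.conjTranspose_mul, ← Matrix.mul_assoc, Matrix.trace_mul_comm]
    simp only [Matrix.mul_assoc]
  simp only [hcyc, ← Matrix.trace_sum, ← Matrix.sum_mul, mixedMap_apply]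

theorem sum_wnorm_intertwining_defect (hB : ∑ s, (B s)ᴴ * B s = 1) (hρ : ρ.IsHermitian)
    (hfix : ∑ s, A s * ρ * (A s)ᴴ = ρ) (Y : Matrix (Fin χ) (Fin χ) ℂ) :
    ∑ s, wnorm ρ (Y * A s - B s * mixedMap B A Y) = wnorm ρ Y - wnorm ρ (mixedMap B A Y) := by
  simp only [wnorm_sub hρ, Finset.sum_add_distrib, Finset.sum_sub_distrib, ← Finset.mul_sum,
    ← Complex.re_sum, sum_trace_mul_tensor_tensor_mul, sum_wnorm_mul_tensor hfix,
    sum_wnorm_tensor_mul hB]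
  rw [← wnorm]
  ring

theorem wnorm_mixedMap_le (hB : ∑ s, (B s)ᴴ * B s = 1) (hρ : ρ.PosDef)
    (hfix : ∑ s, A s * ρ * (A s)ᴴ = ρ) (Y : Matrix (Fin χ) (Fin χ) ℂ) :
    wnorm ρ (mixedMap B A Y) ≤ wnorm ρ Y := by
  have hdefect := Finset.sum_nonneg fun s (_ : s ∈ Finset.univ) =>
    wnorm_nonneg hρ.posSemidef (Y * A s - B s * mixedMap B A Y)
  rw [sum_wnorm_intertwining_defect hB hρ.1 hfix] at hdefect
  exact sub_nonneg.1 hdefect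

theorem mul_tensor_eq_tensor_mul_mixedMap (hB : ∑ s, (B s)ᴴ * B s = 1) (hρ : ρ.PosDef)
    (hfix : ∑ s, A s * ρ * (A s)ᴴ = ρ) {Y : Matrix (Fin χ) (Fin χ) ℂ}
    (hY : wnorm ρ (mixedMap B A Y) = wnorm ρ Y) (s : Fin d) :
    Y * A s = B s * mixedMap B A Y := by
  have hdefect := sum_wnorm_intertwining_defect hB hρ.1 hfix Y
  rw [hY, sub_self, Finset.sum_eq_zero_iff_of_nonneg fun s _ => wnorm_nonneg hρ.posSemidef _]
    at hdefect
  exact sub_eq_zero.1 ((wnorm_eq_zero_iff hρ).1 (hdefect s (Finset.mem_univ s)))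

theorem mixedMap_eq_of_intertwines (hB : ∑ s, (B s)ᴴ * B s = 1)
    {Y Z : Matrix (Fin χ) (Fin χ) ℂ} (h : ∀ s, Y * A s = B s * Z) : mixedMap B A Y = Z := by
  simp only [mixedMap_apply, Matrix.mul_assoc, h]
  simp only [← Matrix.mul_assoc, ← Matrix.sum_mul, hB, Matrix.one_mul]

theorem mixedMap_conjTranspose_mul_self (hB : ∑ s, (B s)ᴴ * B s = 1)
    {Y Z : Matrix (Fin χ) (Fin χ) ℂ} (h : ∀ s, Y * A s = B s * Z) :
    mixedMap A A (Yᴴ * Y) = Zᴴ * Z := by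
  have hterm (s : Fin d) : (A s)ᴴ * (Yᴴ * Y) * A s = Zᴴ * ((B s)ᴴ * B s) * Z := calc
    (A s)ᴴ * (Yᴴ * Y) * A s = (Y * A s)ᴴ * (Y * A s) := by
      simp only [Matrix.conjTranspose_mul, Matrix.mul_assoc]
    _ = Zᴴ * ((B s)ᴴ * B s) * Z := by
      simp only [h, Matrix.conjTranspose_mul, Matrix.mul_assoc]
  simp only [mixedMap_apply, hterm, ← Matrix.sum_mul, ← Matrix.mul_sum, hB, Matrix.mul_one]

theorem IsInjectiveMPS.eq_trace_smul_one_of_wnorm_mixedMap_pow (hA : IsInjectiveMPS A)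
    (hρ : ρ.PosDef) (htr : ρ.trace = 1) (hfix : ∑ s, A s * ρ * (A s)ᴴ = ρ)
    {X : Matrix (Fin χ) (Fin χ) ℂ} (hX : ∀ n, wnorm ρ ((mixedMap A A ^ n) X) = wnorm ρ X) :
    X = (X * ρ).trace • 1 := by
  have hlim := ((continuous_wnorm (ρ := ρ)).tendsto _).comp
    (hA.tendsto_mixedMap_pow hρ.1 htr hfix X)
  have hnorm := tendsto_nhds_unique hlim (tendsto_const_nhds.congr fun n => (hX n).symm)
  rw [wnorm_smul, wnorm_one htr, mul_one] at hnorm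
  rw [← sub_eq_zero, ← wnorm_eq_zero_iff hρ, wnorm_sub_trace_smul_one hρ.1 htr, hnorm, sub_self]

end Contraction

/-! ### Gauge transformations -/

section Gauge

variable {d χ : ℕ} {A : MPSTensor d χ} {B : ℕ → MPSTensor d χ} {L : ℕ}

/-- The gauge transformation `Aˢ ↦ Vᴴ Aˢ V'` of a tensor by matrices `V` and `V'` on its left and
right bonds. -/
def bondAct (V V' : Matrix (Fin χ) (Fin χ) ℂ) (A : MPSTensor d χ) : MPSTensor d χ :=
  fun s => Vᴴ * A s * V'

/-- The orbit of `Y` under the successive mixed maps `Y ↦ ∑ₛ (B_jˢ)ᴴ Y Aˢ`. -/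
def mixedOrbit (B : ℕ → MPSTensor d χ) (A : MPSTensor d χ) (Y : Matrix (Fin χ) (Fin χ) ℂ) :
    ℕ → Matrix (Fin χ) (Fin χ) ℂ
  | 0 => Y
  | j + 1 => mixedMap (B j) A (mixedOrbit B A Y j)

theorem prod_mixedTransfer_conjTranspose_mulVec_vec (B : ℕ → MPSTensor d χ) (A : MPSTensor d χ)
    (Y : Matrix (Fin χ) (Fin χ) ℂ) (n : ℕ) :
    ((List.ofFn fun i : Fin n => mixedTransfer (B i) A).prod)ᴴ *ᵥ Matrix.vec Yᵀ =
      Matrix.vec (mixedOrbit B A Y n)ᵀ := by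
  induction n with
  | zero => simp [mixedOrbit]
  | succ n ih =>
    simp only [List.ofFn_succ', List.concat_eq_append, List.prod_append, List.prod_singleton,
      Fin.val_castSucc, Fin.val_last, Matrix.conjTranspose_mul, ← Matrix.mulVec_mulVec, ih,
      mixedTransfer_conjTranspose_mulVec_vec, mixedOrbit]

theorem mixedOrbit_add_period (hB : Function.Periodic B L) {Y : Matrix (Fin χ) (Fin χ) ℂ} {μ : ℂ}
    (hY : mixedOrbit B A Y L = μ • Y) (j : ℕ) :
    mixedOrbit B A Y (j + L) = μ • mixedOrbit B A Y j := by
  induction j with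
  | zero => rwa [zero_add]
  | succ j ih => rw [add_right_comm, mixedOrbit, mixedOrbit, hB, ih, map_smul]

/-- The states of `A` and of `B` on `k L` sites have overlap of norm `‖Tr T ^ (k L)‖ → 1`, which is
also the norm of the trace of the `k`-th power of the mixed transfer matrix of one period. -/
theorem IsInjectiveMPS.exists_mixedOrbit_eq_smul (hA : IsInjectiveMPS A) (hL : 0 < L)
    (hB : Function.Periodic B L)
    (hstate : ∀ k, 1 ≤ k → PhaseEq (chainState B (k * L)) (mpsState A (k * L)))
    {ρ : Matrix (Fin χ) (Fin χ) ℂ} (hρ : ρ.PosDef) :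
    ∃ (Y : Matrix (Fin χ) (Fin χ) ℂ) (μ : ℂ),
      wnorm ρ Y = 1 ∧ 1 ≤ ‖μ‖ ∧ mixedOrbit B A Y L = μ • Y := by
  set M := (List.ofFn fun i : Fin L => mixedTransfer (B i) A).prod
  have htrace : Tendsto (fun k => ‖(Mᴴ ^ k).trace‖) atTop (𝓝 1) := by
    refine (hA.tendsto_norm_trace_transferMatrix_pow.comp
      (tendsto_id.atTop_mul_const' hL)).congr' ((eventually_ge_atTop 1).mono fun k hk => ?_)
    simp only [← Matrix.conjTranspose_pow, Matrix.trace_conjTranspose, norm_star]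
    exact (norm_trace_mixedTransfer_pow hB (hstate k hk)).symm
  obtain ⟨μ, hμ, hμ1⟩ := one_le_norm_of_tendsto_norm_trace_pow htrace
  obtain ⟨x, hx, hx0⟩ := hμ.exists_hasEigenvector
  obtain ⟨X, rfl⟩ : ∃ X : Matrix (Fin χ) (Fin χ) ℂ, Matrix.vec Xᵀ = x :=
    ⟨fun i j => x (i, j), rfl⟩
  obtain ⟨c, hc⟩ := exists_wnorm_smul_eq_one hρ (X := X) fun h => hx0 (by simp [h])
  refine ⟨c • X, μ, hc, hμ1, Matrix.transpose_injective (Matrix.vec_bijective.injective ?_)⟩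
  rw [← prod_mixedTransfer_conjTranspose_mulVec_vec, ← Matrix.toLin'_apply, Matrix.transpose_smul,
    Matrix.transpose_smul, Matrix.vec_smul, Matrix.vec_smul, map_smul,
    End.mem_eigenspace_iff.1 hx, Matrix.transpose_smul, Matrix.vec_smul, smul_comm]

theorem eq_of_periodic_of_tendsto {α : Type*} [TopologicalSpace α] [T2Space α] {u : ℕ → α} {a : α}
    (hL : 0 < L) (hu : Function.Periodic u L) (h : Tendsto u atTop (𝓝 a)) (n : ℕ) : u n = a :=
  tendsto_nhds_unique
    (tendsto_const_nhds.congr fun k => (hu.nat_mul k n).symm)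
    (h.comp (tendsto_atTop_mono (fun k => Nat.le_add_left (k * L) n)
      (tendsto_id.atTop_mul_const' hL)))

variable {ρ Y : Matrix (Fin χ) (Fin χ) ℂ} {μ : ℂ}

theorem wnorm_mixedOrbit_eq (hBone : ∀ j, ∑ s, (B j s)ᴴ * B j s = 1) (hρ : ρ.PosDef)
    (hfix : ∑ s, A s * ρ * (A s)ᴴ = ρ) (hL : 0 < L) (hB : Function.Periodic B L)
    (hμ : 1 ≤ ‖μ‖) (hY : mixedOrbit B A Y L = μ • Y) (j : ℕ) :
    wnorm ρ (mixedOrbit B A Y j) = wnorm ρ Y := by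
  have hanti : Antitone fun j => wnorm ρ (mixedOrbit B A Y j) :=
    antitone_nat_of_succ_le fun j => wnorm_mixedMap_le (hBone j) hρ hfix _
  have hperiod (j : ℕ) : wnorm ρ (mixedOrbit B A Y j) ≤ wnorm ρ (mixedOrbit B A Y (j + L)) := by
    rw [mixedOrbit_add_period hB hY, wnorm_smul]
    exact le_mul_of_one_le_left (wnorm_nonneg hρ.posSemidef _) (one_le_pow₀ hμ)
  induction j with
  | zero => rfl
  | succ j ih =>
    rw [← ih]
    exact le_antisymm (hanti j.le_succ) ((hperiod j).trans (hanti (Nat.add_le_add_left hL j)))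

theorem IsInjectiveMPS.conjTranspose_mul_mixedOrbit (hA : IsInjectiveMPS A)
    (hBone : ∀ j, ∑ s, (B j s)ᴴ * B j s = 1) (hρ : ρ.PosDef) (htr : ρ.trace = 1)
    (hfix : ∑ s, A s * ρ * (A s)ᴴ = ρ) (hL : 0 < L) (hB : Function.Periodic B L)
    (hY : mixedOrbit B A Y L = μ • Y) (hY1 : ∀ j, wnorm ρ (mixedOrbit B A Y j) = 1)
    (hinter : ∀ j s, mixedOrbit B A Y j * A s = B j s * mixedOrbit B A Y (j + 1)) (n : ℕ) :
    (mixedOrbit B A Y n)ᴴ * mixedOrbit B A Y n = 1 := by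
  set y := mixedOrbit B A Y
  have hμ : μ * star μ = 1 := by
    have hnorm := hY1 L
    rw [hY, wnorm_smul, show wnorm ρ Y = 1 from hY1 0, mul_one] at hnorm
    rw [Complex.star_def, Complex.mul_conj', ← Complex.ofReal_pow, hnorm, Complex.ofReal_one]
  have hperiodic : Function.Periodic (fun n => (y n)ᴴ * y n) L := fun n => by
    simp only [y, mixedOrbit_add_period hB hY, Matrix.conjTranspose_smul, Matrix.smul_mul,
      Matrix.mul_smul, smul_smul, hμ, one_smul]
  have hpow (n : ℕ) : (mixedMap A A ^ n) (Yᴴ * Y) = (y n)ᴴ * y n := by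
    induction n with
    | zero => rfl
    | succ n ih =>
      rw [pow_succ', End.mul_apply, ih, mixedMap_conjTranspose_mul_self (hBone n) (hinter n)]
  have hlim : Tendsto (fun n => (y n)ᴴ * y n) atTop (𝓝 1) := by
    have htrace : (Yᴴ * Y * ρ).trace = 1 := by
      rw [Matrix.mul_assoc, Matrix.trace_mul_comm, ← coe_wnorm hρ.posSemidef,
        show wnorm ρ Y = 1 from hY1 0, Complex.ofReal_one]
    have h := hA.tendsto_mixedMap_pow hρ.1 htr hfix (Yᴴ * Y)
    simpa only [hpow, htrace, one_smul] using h
  exact eq_of_periodic_of_tendsto hL hperiodic hlim n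

theorem IsInjectiveMPS.exists_unitary_gauge (hA : IsInjectiveMPS A)
    (hBone : ∀ j, ∑ s, (B j s)ᴴ * B j s = 1) (hL : 0 < L) (hB : Function.Periodic B L)
    (hstate : ∀ k, 1 ≤ k → PhaseEq (chainState B (k * L)) (mpsState A (k * L))) :
    ∃ v : ℕ → Matrix.unitaryGroup (Fin χ) ℂ, ∀ j, B j = bondAct (v j) (v (j + 1)) A := by
  obtain ⟨ρ, hρ, htr, hfix⟩ := hA.exists_stationary_state
  obtain ⟨Y, μ, hY1, hμ, hY⟩ := hA.exists_mixedOrbit_eq_smul hL hB hstate hρ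
  have hwnorm (j : ℕ) : wnorm ρ (mixedOrbit B A Y j) = 1 :=
    (wnorm_mixedOrbit_eq hBone hρ hfix hL hB hμ hY j).trans hY1
  have hinter (j : ℕ) (s : Fin d) :
      mixedOrbit B A Y j * A s = B j s * mixedOrbit B A Y (j + 1) :=
    mul_tensor_eq_tensor_mul_mixedMap (hBone j) hρ hfix
      ((hwnorm (j + 1)).trans (hwnorm j).symm) s
  have hunit := hA.conjTranspose_mul_mixedOrbit hBone hρ htr hfix hL hB hY hwnorm hinter
  refine ⟨fun j => star ⟨mixedOrbit B A Y j, Matrix.mem_unitaryGroup_iff'.2 (hunit j)⟩, fun j => ?_⟩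
  funext s
  change B j s = (mixedOrbit B A Y j)ᴴᴴ * A s * (mixedOrbit B A Y (j + 1))ᴴ
  rw [Matrix.conjTranspose_conjTranspose, hinter, Matrix.mul_assoc,
    mul_eq_one_comm.1 (hunit (j + 1)), Matrix.mul_one]

theorem phaseEq_mixedMap_pow {u : ℕ → Matrix (Fin χ) (Fin χ) ℂ}
    (h : ∀ j, PhaseEq (mixedMap A A (u j)) (u (j + 1))) (j n : ℕ) :
    PhaseEq ((mixedMap A A ^ n) (u j)) (u (j + n)) := by
  induction n with
  | zero => exact ⟨1, by simp⟩
  | succ n ih =>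
    rw [pow_succ', End.mul_apply]
    exact (ih.map _).trans (h (j + n))

theorem phaseEq_one_of_eq_smul_one (htr : ρ.trace = 1) {u : Matrix (Fin χ) (Fin χ) ℂ}
    (hu : u ∈ Matrix.unitaryGroup (Fin χ) ℂ) {c : ℂ} (h : u = c • 1) : PhaseEq u 1 := by
  have hc := wnorm_of_mem_unitaryGroup htr hu
  rw [h, wnorm_smul, wnorm_one htr, mul_one,
    pow_eq_one_iff_of_nonneg (norm_nonneg c) two_ne_zero] at hc
  exact ⟨⟨c, mem_sphere_zero_iff_norm.2 hc⟩, h⟩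

theorem IsInjectiveMPS.phaseEq_of_mixedMap (hA : IsInjectiveMPS A)
    {u : ℕ → Matrix (Fin χ) (Fin χ) ℂ} (hu : ∀ j, u j ∈ Matrix.unitaryGroup (Fin χ) ℂ)
    (h : ∀ j, PhaseEq (mixedMap A A (u j)) (u (j + 1))) (j : ℕ) : PhaseEq (u j) 1 := by
  obtain ⟨ρ, hρ, htr, hfix⟩ := hA.exists_stationary_state
  refine phaseEq_one_of_eq_smul_one htr (hu j)
    (hA.eq_trace_smul_one_of_wnorm_mixedMap_pow hρ htr hfix fun n => ?_)
  rw [(phaseEq_mixedMap_pow h j n).wnorm_eq, wnorm_of_mem_unitaryGroup htr (hu j),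
    wnorm_of_mem_unitaryGroup htr (hu (j + n))]

theorem IsInjectiveMPS.phaseEq_of_bondAct (hA : IsInjectiveMPS A)
    {v w : ℕ → Matrix.unitaryGroup (Fin χ) ℂ}
    (h : ∀ j, PhaseEq (bondAct (v j) (v (j + 1)) A) (bondAct (w j) (w (j + 1)) A)) (j : ℕ) :
    PhaseEq (v j : Matrix (Fin χ) (Fin χ) ℂ) (w j) := by
  have hstar (x : Matrix.unitaryGroup (Fin χ) ℂ) : (x : Matrix (Fin χ) (Fin χ) ℂ)ᴴ * x = 1 :=
    Matrix.mem_unitaryGroup_iff'.1 x.2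
  have hstar' (x : Matrix.unitaryGroup (Fin χ) ℂ) : (x : Matrix (Fin χ) (Fin χ) ℂ) * (x)ᴴ = 1 :=
    Matrix.mem_unitaryGroup_iff.1 x.2
  set u : ℕ → Matrix (Fin χ) (Fin χ) ℂ := fun j => v j * (w j : Matrix (Fin χ) (Fin χ) ℂ)ᴴ
  have hphase := hA.phaseEq_of_mixedMap (u := u) (fun j => (v j * star (w j)).2) fun j => by
    obtain ⟨φ, hφ⟩ := (h j).symm
    refine ⟨φ, mixedMap_eq_of_intertwines hA.left_canonical fun s => ?_⟩
    have hs : (w j : Matrix (Fin χ) (Fin χ) ℂ)ᴴ * A s * w (j + 1) =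
      (φ : ℂ) • ((v j : Matrix (Fin χ) (Fin χ) ℂ)ᴴ * A s * v (j + 1)) := congrFun hφ s
    calc u j * A s
        = v j * ((w j : Matrix (Fin χ) (Fin χ) ℂ)ᴴ * A s * w (j + 1)) *
            (w (j + 1) : Matrix (Fin χ) (Fin χ) ℂ)ᴴ := by
          simp only [u, Matrix.mul_assoc, hstar', Matrix.mul_one]
      _ = (φ : ℂ) • (v j * (v j : Matrix (Fin χ) (Fin χ) ℂ)ᴴ * A s * u (j + 1)) := by
          simp only [hs, u, Matrix.mul_smul, Matrix.smul_mul, Matrix.mul_assoc]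
      _ = A s * ((φ : ℂ) • u (j + 1)) := by rw [hstar', Matrix.one_mul, Matrix.mul_smul]
  obtain ⟨θ, hθ⟩ := hphase j
  exact ⟨θ, by rw [← Matrix.one_mul (w j : Matrix (Fin χ) (Fin χ) ℂ), ← Matrix.smul_mul, ← hθ,
    Matrix.mul_assoc, hstar, Matrix.mul_one]⟩

end Gauge

/-! ### Two-cocycles on abelian groups -/

section Cohomology

/-- The commutator pairing `ω(g, h) / ω(h, g)` of a cocycle, a complete invariant of its class when
the group is abelian. -/
def cocycleComm {G : Type*} (ω : G → G → Circle) (g h : G) : Circle := ω g h / ω h g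

theorem inv_cocycleComm {G : Type*} (ω : G → G → Circle) (g h : G) :
    (cocycleComm ω g h)⁻¹ = cocycleComm ω h g :=
  inv_div _ _

theorem cocycleComm_self {G : Type*} (ω : G → G → Circle) (g : G) : cocycleComm ω g g = 1 :=
  div_self' _

variable {G : Type*} [CommGroup G] {ω ω' ω₁ ω₂ ω₃ : G → G → Circle}

theorem Cohomologous.refl (ω : G → G → Circle) : Cohomologous ω ω :=
  ⟨fun _ => 1, fun g h => by simp⟩

theorem Cohomologous.symm (h : Cohomologous ω ω') : Cohomologous ω' ω := by
  obtain ⟨β, hβ⟩ := h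
  exact ⟨fun g => (β g)⁻¹, fun g h => calc
    ω' g h / ω g h = (ω g h / ω' g h)⁻¹ := (inv_div ..).symm
    _ = (β g)⁻¹ * (β h)⁻¹ / (β (g * h))⁻¹ :=
      (congrArg _ (hβ g h)).trans (by rw [inv_div', mul_inv])⟩

theorem Cohomologous.trans (h : Cohomologous ω₁ ω₂) (h' : Cohomologous ω₂ ω₃) :
    Cohomologous ω₁ ω₃ := by
  obtain ⟨β, hβ⟩ := h
  obtain ⟨β', hβ'⟩ := h'
  exact ⟨fun g => β g * β' g, fun g h => calc
    ω₁ g h / ω₃ g h = ω₁ g h / ω₂ g h * (ω₂ g h / ω₃ g h) := (div_mul_div_cancel ..).symm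
    _ = β g * β' g * (β h * β' h) / (β (g * h) * β' (g * h)) := by
      rw [mul_mul_mul_comm, ← div_mul_div_comm]; exact congrArg₂ _ (hβ g h) (hβ' g h)⟩

theorem IsTwoCocycle.comp_zpow (hω : IsTwoCocycle ω) (b : ℤ) :
    IsTwoCocycle fun g h => ω (g ^ b) (h ^ b) := fun g h l => by
  simpa only [mul_zpow] using hω (g ^ b) (h ^ b) (l ^ b)

theorem IsTwoCocycle.zpow (hω : IsTwoCocycle ω) (n : ℤ) :
    IsTwoCocycle fun g h => ω g h ^ n := fun g h l => by
  simp only [← mul_zpow, hω g h l]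

theorem IsTwoCocycle.div (hω : IsTwoCocycle ω) (hω' : IsTwoCocycle ω') :
    IsTwoCocycle fun g h => ω g h / ω' g h := fun g h l => by
  simp only [div_mul_div_comm, hω g h l, hω' g h l]

theorem cocycleComm_mul_left (hω : IsTwoCocycle ω) (g h l : G) :
    cocycleComm ω (g * h) l = cocycleComm ω g l * cocycleComm ω h l := by
  have hratio : ω g (h * l) / ω (l * g) h = ω g l / ω l h := by
    rw [div_eq_div_iff_mul_eq_mul, mul_comm h l, mul_comm l g, hω g l h, mul_comm]
  calc cocycleComm ω (g * h) l
      = ω g h * ω (g * h) l / (ω g h * ω l (g * h)) := (mul_div_mul_left_eq_div _ _ _).symm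
    _ = ω h l * ω g (h * l) / (ω l g * ω (l * g) h) := by rw [hω g h l, hω l g h]
    _ = ω h l / ω l g * (ω g l / ω l h) := by rw [mul_div_mul_comm, hratio]
    _ = cocycleComm ω g l * cocycleComm ω h l := by
      rw [cocycleComm, cocycleComm, div_mul_div_comm, div_mul_div_comm, mul_comm (ω h l)]

theorem cocycleComm_mul_right (hω : IsTwoCocycle ω) (g h l : G) :
    cocycleComm ω g (h * l) = cocycleComm ω g h * cocycleComm ω g l := by
  simp only [← inv_cocycleComm ω _ g, cocycleComm_mul_left hω, mul_inv]

theorem cocycleComm_zpow_left (hω : IsTwoCocycle ω) (g l : G) (n : ℤ) :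
    cocycleComm ω (g ^ n) l = cocycleComm ω g l ^ n :=
  map_zpow (MonoidHom.mk' (cocycleComm ω · l) fun g h => cocycleComm_mul_left hω g h l) g n

theorem cocycleComm_zpow_right (hω : IsTwoCocycle ω) (g l : G) (n : ℤ) :
    cocycleComm ω g (l ^ n) = cocycleComm ω g l ^ n :=
  map_zpow (MonoidHom.mk' (cocycleComm ω g) (cocycleComm_mul_right hω g)) l n

theorem IsTwoCocycle.one_left (hω : IsTwoCocycle ω) (g : G) : ω 1 g = ω 1 1 := by
  simpa using (hω 1 1 g).symm

/-- The central extension of `G` by `U(1)` with cocycle `ω`, as a set of pairs. -/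
@[ext]
structure CocycleExt (ω : G → G → Circle) where
  /-- The component in `G`. -/
  elt : G
  /-- The component in `U(1)`. -/
  phase : Circle

/-- The group structure `(g, a) (h, b) = (g h, a b ω(g, h))` on the extension by a symmetric
cocycle. The cocycle is not assumed to be normalized, so the unit is `(1, ω(1, 1)⁻¹)`. -/
abbrev CocycleExt.commGroup (hω : IsTwoCocycle ω) (hsymm : ∀ g h, ω g h = ω h g) :
    CommGroup (CocycleExt ω) :=
  letI : Mul (CocycleExt ω) := ⟨fun x y => ⟨x.elt * y.elt, x.phase * y.phase * ω x.elt y.elt⟩⟩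
  letI : One (CocycleExt ω) := ⟨⟨1, (ω 1 1)⁻¹⟩⟩
  letI : Inv (CocycleExt ω) := ⟨fun x => ⟨x.elt⁻¹, (x.phase * ω x.elt x.elt⁻¹ * ω 1 1)⁻¹⟩⟩
  { Group.ofLeftAxioms (G := CocycleExt ω)
      (fun x y z => CocycleExt.ext (mul_assoc x.elt y.elt z.elt) <| calc
        x.phase * y.phase * ω x.elt y.elt * z.phase * ω (x.elt * y.elt) z.elt
          = x.phase * y.phase * z.phase * (ω x.elt y.elt * ω (x.elt * y.elt) z.elt) := by
            simp only [mul_comm, mul_left_comm]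
        _ = x.phase * (y.phase * z.phase * ω y.elt z.elt) * ω x.elt (y.elt * z.elt) := by
            rw [hω]; simp only [mul_comm, mul_left_comm])
      (fun x => CocycleExt.ext (one_mul x.elt) <|
        show (ω 1 1)⁻¹ * x.phase * ω 1 x.elt = x.phase by
          rw [hω.one_left x.elt, mul_right_comm, inv_mul_cancel, one_mul])
      (fun x => CocycleExt.ext (inv_mul_cancel x.elt) <|
        show (x.phase * ω x.elt x.elt⁻¹ * ω 1 1)⁻¹ * x.phase * ω x.elt⁻¹ x.elt = (ω 1 1)⁻¹ by
          rw [hsymm x.elt⁻¹, mul_assoc, mul_inv_rev, mul_assoc, inv_mul_cancel, mul_one]) with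
    mul_comm := fun x y => CocycleExt.ext (mul_comm x.elt y.elt) <|
      show x.phase * y.phase * ω x.elt y.elt = y.phase * x.phase * ω y.elt x.elt by
        rw [hsymm, mul_comm x.phase] }

/-- Every element of `U(1)` has roots of all orders. -/
abbrev circleDivisible : DivisibleBy (Additive Circle) ℤ :=
  divisibleByOfSMulRightSurj _ _ fun {n} hn z =>
    ⟨.ofMul (Circle.exp (Complex.arg (z.toMul : Circle) / n)), Additive.toMul.injective <| by
      rw [toMul_zsmul, toMul_ofMul, ← Circle.exp_zsmul, zsmul_eq_mul,
        mul_div_cancel₀ _ (Int.cast_ne_zero.2 hn), Circle.exp_arg]⟩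

/-- The extension by a symmetric cocycle is abelian, and it splits because `U(1)` is divisible,
hence injective; restricting the splitting to the section `g ↦ (g, 1)` trivializes `ω`. -/
theorem isTwoCoboundary_of_symmetric (hω : IsTwoCocycle ω) (hsymm : ∀ g h, ω g h = ω h g) :
    IsTwoCoboundary ω := by
  let := CocycleExt.commGroup hω hsymm
  let ι : Circle →* CocycleExt ω := MonoidHom.mk' (fun a => ⟨1, a * (ω 1 1)⁻¹⟩) fun a b =>
    CocycleExt.ext (one_mul 1).symm <|
      show a * b * (ω 1 1)⁻¹ = a * (ω 1 1)⁻¹ * (b * (ω 1 1)⁻¹) * ω 1 1 by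
        rw [mul_assoc (a * _), inv_mul_cancel_right, mul_right_comm]
  have hι : Function.Injective ι := fun a b h => mul_right_cancel (congrArg CocycleExt.phase h)
  have := circleDivisible
  obtain ⟨r, hr⟩ : ∃ r : CocycleExt ω →* Circle, ∀ a, r (ι a) = a := by
    obtain ⟨r, hr⟩ := (Module.Baer.of_divisible (Additive Circle)).extension_property_addMonoidHom
      (MonoidHom.toAdditive ι) hι (AddMonoidHom.id _)
    exact ⟨AddMonoidHom.toMultiplicative r, fun a => DFunLike.congr_fun hr (Additive.ofMul a)⟩
  refine ⟨fun g => r ⟨g, 1⟩, fun g h => ?_⟩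
  have hsplit : (⟨g, 1⟩ * ⟨h, 1⟩ : CocycleExt ω) = ι (ω g h) * ⟨g * h, 1⟩ :=
    CocycleExt.ext (one_mul (g * h)).symm <|
      show 1 * 1 * ω g h = ω g h * (ω 1 1)⁻¹ * 1 * ω 1 (g * h) by
        rw [hω.one_left (g * h), mul_one, mul_one, one_mul, inv_mul_cancel_right]
  rw [← map_mul, hsplit, map_mul, hr, mul_div_cancel_right]

theorem isTwoCoboundary_of_cocycleComm_eq_one (hω : IsTwoCocycle ω)
    (h : ∀ g h, cocycleComm ω g h = 1) : IsTwoCoboundary ω :=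
  isTwoCoboundary_of_symmetric hω fun g k => div_eq_one.1 (h g k)

theorem IsTwoCocycle.cohomologous_comp_zpow (hω : IsTwoCocycle ω) (b : ℤ) :
    Cohomologous (fun g h => ω (g ^ b) (h ^ b)) (fun g h => ω g h ^ (b ^ 2)) := by
  refine isTwoCoboundary_of_cocycleComm_eq_one ((hω.comp_zpow b).div (hω.zpow (b ^ 2)))
    fun g h => ?_
  calc ω (g ^ b) (h ^ b) / ω g h ^ b ^ 2 / (ω (h ^ b) (g ^ b) / ω h g ^ b ^ 2)
      = cocycleComm ω (g ^ b) (h ^ b) / cocycleComm ω g h ^ b ^ 2 := by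
        rw [div_div_div_comm, ← div_zpow, cocycleComm, cocycleComm]
    _ = 1 := by
        rw [cocycleComm_zpow_left hω, cocycleComm_zpow_right hω, ← zpow_mul, ← sq, div_self']

theorem IsTwoCocycle.cohomologous_comp_zpow_iff (hω : IsTwoCocycle ω) (b : ℤ) :
    Cohomologous ω (fun g h => ω (g ^ b) (h ^ b)) ↔
      IsTwoCoboundary fun g h => ω g h ^ (b ^ 2 - 1) := by
  have hpow : Cohomologous (fun g h => ω g h ^ (b ^ 2)) ω ↔
      IsTwoCoboundary fun g h => ω g h ^ (b ^ 2 - 1) := by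
    simp only [Cohomologous, zpow_sub, zpow_one, div_eq_mul_inv]
  rw [← hpow]
  exact ⟨fun h => (h.trans (hω.cohomologous_comp_zpow b)).symm,
    fun h => ((hω.cohomologous_comp_zpow b).trans h).symm⟩

end Cohomology

/-! ### Virtual representations of exponential symmetries -/

section Projective

theorem circle_smul_left_cancel {m n : Type*} {M : Matrix m n ℂ} (hM : M ≠ 0) {a c : Circle}
    (h : (a : ℂ) • M = (c : ℂ) • M) : a = c :=
  Circle.coe_injective (smul_left_injective ℂ hM h)

variable {n G : Type*} [Fintype n] [DecidableEq n] [CommGroup G]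

/-- `V` is a projective unitary representation with factor system `ω`. -/
def IsProjectiveRep (V : G → Matrix.unitaryGroup n ℂ) (ω : G → G → Circle) : Prop :=
  ∀ g h, (V g : Matrix n n ℂ) * (V h : Matrix n n ℂ) =
    (ω g h : ℂ) • (V (g * h) : Matrix n n ℂ)

theorem coe_unitaryGroup_ne_zero [Nonempty n] (V : Matrix.unitaryGroup n ℂ) :
    (V : Matrix n n ℂ) ≠ 0 := fun h =>
  zero_ne_one <| by simpa only [h, mul_zero] using Matrix.mem_unitaryGroup_iff'.1 V.2

variable {V V' : G → Matrix.unitaryGroup n ℂ} {ω ω' : G → G → Circle}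

theorem IsProjectiveRep.isTwoCocycle [Nonempty n] (hV : IsProjectiveRep V ω) :
    IsTwoCocycle ω := by
  intro g h l
  refine circle_smul_left_cancel (coe_unitaryGroup_ne_zero (V (g * h * l))) ?_
  have hassoc := Matrix.mul_assoc (V g : Matrix n n ℂ) (V h : Matrix n n ℂ) (V l : Matrix n n ℂ)
  rw [hV, hV, Matrix.smul_mul, Matrix.mul_smul, hV, hV, smul_smul, smul_smul,
    ← mul_assoc g h l] at hassoc
  rwa [Circle.coe_mul, Circle.coe_mul]

theorem IsProjectiveRep.comp_zpow (hV : IsProjectiveRep V ω) (b : ℤ) :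
    IsProjectiveRep (fun g => V (g ^ b)) fun g h => ω (g ^ b) (h ^ b) := fun g h => by
  simpa only [mul_zpow] using hV (g ^ b) (h ^ b)

theorem IsProjectiveRep.cohomologous_of_phaseEq [Nonempty n] (hV : IsProjectiveRep V ω)
    (hV' : IsProjectiveRep V' ω')
    (h : ∀ g, PhaseEq (V g : Matrix n n ℂ) (V' g : Matrix n n ℂ)) : Cohomologous ω ω' := by
  choose θ hθ using h
  refine ⟨θ, fun g k => div_eq_div_iff_mul_eq_mul.2 <|
    circle_smul_left_cancel (coe_unitaryGroup_ne_zero (V' (g * k))) ?_⟩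
  have hmul := hV g k
  rw [hθ g, hθ k, hθ (g * k), Matrix.smul_mul, Matrix.mul_smul, hV', smul_smul, smul_smul,
    smul_smul] at hmul
  rw [Circle.coe_mul, Circle.coe_mul, Circle.coe_mul, ← hmul, mul_assoc]

end Projective

section PhysAct

variable {d χ : ℕ}

theorem physAct_mul (W W' : Matrix (Fin d) (Fin d) ℂ) (A : MPSTensor d χ) :
    physAct (W * W') A = physAct W (physAct W' A) := by
  funext s
  simp only [physAct, Matrix.mul_apply, Finset.sum_smul, Finset.smul_sum, smul_smul]
  exact Finset.sum_comm

theorem physAct_smul_bondAct (W : Matrix (Fin d) (Fin d) ℂ) (c : ℂ)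
    (V V' : Matrix (Fin χ) (Fin χ) ℂ) (A : MPSTensor d χ) :
    physAct W (c • bondAct V V' A) = c • bondAct V V' (physAct W A) := by
  funext s
  simp only [physAct, bondAct, Pi.smul_apply, Matrix.mul_sum, Matrix.sum_mul, Finset.smul_sum,
    Matrix.mul_smul, Matrix.smul_mul, smul_comm c]

theorem bondAct_smul_bondAct (c : ℂ) (V V' W W' : Matrix (Fin χ) (Fin χ) ℂ)
    (A : MPSTensor d χ) :
    bondAct W W' (c • bondAct V V' A) = c • bondAct (V * W) (V' * W') A := by
  funext s
  simp only [bondAct, Pi.smul_apply, Matrix.mul_smul, Matrix.smul_mul, Matrix.conjTranspose_mul,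
    Matrix.mul_assoc]

theorem sum_conjTranspose_mul_physAct {W : Matrix (Fin d) (Fin d) ℂ} (hW : Wᴴ * W = 1)
    (A : MPSTensor d χ) :
    ∑ s, (physAct W A s)ᴴ * physAct W A s = ∑ s, (A s)ᴴ * A s := by
  have hW_apply (t u : Fin d) : ∑ s, star (W s t) * W s u = if t = u then 1 else 0 := by
    simpa only [Matrix.mul_apply, Matrix.conjTranspose_apply, Matrix.one_apply]
      using congrFun₂ hW t u
  calc ∑ s, (physAct W A s)ᴴ * physAct W A s
      = ∑ t, ∑ u, (∑ s, star (W s t) * W s u) • ((A t)ᴴ * A u) := by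
        simp only [physAct, Matrix.conjTranspose_sum, Matrix.conjTranspose_smul,
          Finset.sum_mul_sum, Matrix.smul_mul, Matrix.mul_smul, smul_smul, Finset.sum_smul,
          mul_comm (W _ _)]
        rw [Finset.sum_comm]
        exact Finset.sum_congr rfl fun t _ => Finset.sum_comm
    _ = ∑ s, (A s)ᴴ * A s := by
        simp only [hW_apply, ite_smul, one_smul, zero_smul, Finset.sum_ite_eq, Finset.mem_univ,
          if_true]

end PhysAct

section Symmetry

variable {G : Type*} [CommGroup G] {d χ : ℕ} {A : MPSTensor d χ}
  {U : G →* Matrix.unitaryGroup (Fin d) ℂ} {b : ℤ}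

theorem onSite_eq (g : G) (j : ℕ) :
    onSite U b g j = (U (g ^ (b ^ j)) : Matrix (Fin d) (Fin d) ℂ) := by
  rw [onSite, map_zpow]

theorem onSite_mul (g h : G) (j : ℕ) :
    onSite U b (g * h) j = onSite U b g j * onSite U b h j := by
  simp only [onSite_eq, mul_zpow, map_mul, Submonoid.coe_mul]

theorem onSite_zpow (g : G) (j : ℕ) : onSite U b (g ^ b) j = onSite U b g (j + 1) := by
  simp only [onSite_eq, ← zpow_mul, pow_succ']

theorem onSite_add_period {L : ℕ} (h : ∀ g : G, U g ^ (b ^ L) = U g) (g : G) (j : ℕ) :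
    onSite U b g (j + L) = onSite U b g j := by
  rw [onSite, onSite, pow_add, mul_comm, zpow_mul, h]

theorem onSite_conjTranspose_mul (g : G) (j : ℕ) : (onSite U b g j)ᴴ * onSite U b g j = 1 :=
  Matrix.mem_unitaryGroup_iff'.1 (U g ^ (b ^ j)).2

theorem physAct_onSite_mul_eq {g h : G} {j : ℕ} {c c' : ℂ} {V V' W W' : Matrix (Fin χ) (Fin χ) ℂ}
    (hg : physAct (onSite U b g j) A = c • bondAct V V' A)
    (hh : physAct (onSite U b h j) A = c' • bondAct W W' A) :
    physAct (onSite U b (g * h) j) A = (c * c') • bondAct (V * W) (V' * W') A := by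
  rw [onSite_mul, physAct_mul, hh, physAct_smul_bondAct, hg, bondAct_smul_bondAct, smul_smul,
    mul_comm]

theorem IsInjectiveMPS.exists_isVirtualRep (hA : IsInjectiveMPS A) {L : ℕ} (hL : 0 < L)
    (hS : HasExpSymmetry A U b L) :
    ∃ (v : ℕ → G → Matrix.unitaryGroup (Fin χ) ℂ) (ω : ℕ → G → G → Circle),
      IsVirtualRep A U b v ω := by
  have hgauge (g : G) : ∃ v : ℕ → Matrix.unitaryGroup (Fin χ) ℂ,
      ∀ j, physAct (onSite U b g j) A = bondAct (v j) (v (j + 1)) A :=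
    hA.exists_unitary_gauge
      (fun j => (sum_conjTranspose_mul_physAct (onSite_conjTranspose_mul g j) A).trans
        hA.left_canonical)
      hL (fun j => by simp only [onSite_add_period hS.periodic])
      fun k hk => by rw [← siteTensor_mulVec_mpsState]; exact hS.eigenstate k hk g
  choose v hv using hgauge
  have hproj (j : ℕ) (g h : G) : PhaseEq
      ((v g j * v h j : Matrix.unitaryGroup (Fin χ) ℂ) : Matrix (Fin χ) (Fin χ) ℂ)
      (v (g * h) j : Matrix (Fin χ) (Fin χ) ℂ) := by
    refine hA.phaseEq_of_bondAct (v := fun j => v g j * v h j) (fun j => ⟨1, ?_⟩) j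
    have hmul := physAct_onSite_mul_eq ((hv g j).trans (one_smul ℂ _).symm)
      ((hv h j).trans (one_smul ℂ _).symm)
    rw [mul_one, one_smul] at hmul
    rw [Circle.coe_one, one_smul, ← hv, hmul]
    rfl
  choose ω hω using hproj
  exact ⟨fun j g => v g j, ω, fun j g => ⟨1, fun s => by rw [hv, Circle.coe_one, one_smul]; rfl⟩,
    hω⟩

variable {v v' : ℕ → G → Matrix.unitaryGroup (Fin χ) ℂ} {ω ω' : ℕ → G → G → Circle}

theorem IsVirtualRep.phaseEq_physAct (hv : IsVirtualRep A U b v ω) (j : ℕ) (g : G) :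
    PhaseEq (physAct (onSite U b g j) A) (bondAct (v j g) (v (j + 1) g) A) :=
  (hv.push_through j g).imp fun _ hφ => funext hφ

theorem IsVirtualRep.isProjectiveRep (hv : IsVirtualRep A U b v ω) (j : ℕ) :
    IsProjectiveRep (v j) (ω j) :=
  hv.projective j

theorem IsVirtualRep.phaseEq (hA : IsInjectiveMPS A) (hv : IsVirtualRep A U b v ω)
    (hv' : IsVirtualRep A U b v' ω') (j : ℕ) (g : G) :
    PhaseEq (v j g : Matrix (Fin χ) (Fin χ) ℂ) (v' j g) :=
  hA.phaseEq_of_bondAct (v := (v · g)) (w := (v' · g))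
    (fun i => (hv.phaseEq_physAct i g).symm.trans (hv'.phaseEq_physAct i g)) j

/-- The symmetry operator of `g ^ b` is that of `g` shifted by one site, so the bond unitaries of
`g ^ b` and the shifted ones of `g` solve the same gauge problem. -/
theorem IsVirtualRep.phaseEq_succ (hA : IsInjectiveMPS A) (hv : IsVirtualRep A U b v ω) (j : ℕ)
    (g : G) : PhaseEq (v (j + 1) g : Matrix (Fin χ) (Fin χ) ℂ) (v j (g ^ b)) :=
  hA.phaseEq_of_bondAct (v := fun i => v (i + 1) g) (w := fun i => v i (g ^ b)) (fun i =>
    (hv.phaseEq_physAct (i + 1) g).symm.trans <| by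
      rw [← onSite_zpow]; exact hv.phaseEq_physAct i (g ^ b)) j

theorem bondAct_ne_zero (hA : A ≠ 0) (V V' : Matrix.unitaryGroup (Fin χ) ℂ) :
    bondAct (V : Matrix (Fin χ) (Fin χ) ℂ) V' A ≠ 0 := fun h => hA <| by
  have hV : (V : Matrix (Fin χ) (Fin χ) ℂ) * (V : Matrix (Fin χ) (Fin χ) ℂ)ᴴ = 1 :=
    Matrix.mem_unitaryGroup_iff.1 V.2
  have hV' : (V' : Matrix (Fin χ) (Fin χ) ℂ) * (V' : Matrix (Fin χ) (Fin χ) ℂ)ᴴ = 1 :=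
    Matrix.mem_unitaryGroup_iff.1 V'.2
  funext s
  calc A s = (V : Matrix (Fin χ) (Fin χ) ℂ) * bondAct (V : Matrix (Fin χ) (Fin χ) ℂ) V' A s *
        (V' : Matrix (Fin χ) (Fin χ) ℂ)ᴴ := by
        simp only [bondAct, Matrix.mul_assoc, hV', mul_one]
        rw [← Matrix.mul_assoc, hV, one_mul]
    _ = 0 := by rw [h, Pi.zero_apply, Matrix.mul_zero, Matrix.zero_mul]

theorem IsInjectiveMPS.ne_zero (hA : IsInjectiveMPS A) : A ≠ 0 := by
  have := hA.nonempty_bond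
  rintro rfl
  simpa using hA.left_canonical

/-- On a linear on-site representation the factor systems of the two bonds of a site have to cancel
up to the phases in the push-through relation. -/
theorem IsVirtualRep.cohomologous_succ (hA : IsInjectiveMPS A) (hv : IsVirtualRep A U b v ω)
    (j : ℕ) : Cohomologous (ω j) (ω (j + 1)) := by
  choose φ hφ using hv.phaseEq_physAct j
  refine ⟨φ, fun g k => ?_⟩
  have hmul := physAct_onSite_mul_eq (hφ g) (hφ k)
  obtain ⟨s, hs⟩ := Function.ne_iff.1 (bondAct_ne_zero hA.ne_zero (v j (g * k)) (v (j + 1) (g * k)))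
  have hfactor : φ (g * k) = φ g * φ k * (ω (j + 1) g k * (ω j g k)⁻¹) := by
    refine circle_smul_left_cancel hs ?_
    have hmul_apply := congrFun ((hφ (g * k)).symm.trans hmul) s
    rw [hv.projective, hv.projective] at hmul_apply
    simp only [bondAct, Pi.smul_apply, Matrix.conjTranspose_smul, Matrix.smul_mul,
      Matrix.mul_smul, smul_smul] at hmul_apply
    simp only [bondAct, Circle.coe_mul, Circle.coe_inv_eq_conj]
    exact hmul_apply
  rw [hfactor, div_eq_div_iff_mul_eq_mul, mul_left_comm, mul_left_comm (ω j g k),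
    mul_inv_cancel, mul_one]

theorem IsVirtualRep.cohomologous (hA : IsInjectiveMPS A) (hv : IsVirtualRep A U b v ω)
    (i j : ℕ) : Cohomologous (ω i) (ω j) := by
  have hzero (i : ℕ) : Cohomologous (ω 0) (ω i) := by
    induction i with
    | zero => exact Cohomologous.refl _
    | succ i ih => exact ih.trans (hv.cohomologous_succ hA i)
  exact (hzero i).symm.trans (hzero j)

theorem IsVirtualRep.cohomologous_comp_zpow (hA : IsInjectiveMPS A)
    (hv : IsVirtualRep A U b v ω) (j : ℕ) :
    Cohomologous (ω j) (fun g h => ω j (g ^ b) (h ^ b)) := by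
  have := hA.nonempty_bond
  exact (hv.cohomologous_succ hA j).trans <| (hv.isProjectiveRep (j + 1)).cohomologous_of_phaseEq
    ((hv.isProjectiveRep j).comp_zpow b) (hv.phaseEq_succ hA j)

theorem IsVirtualRep.isTwoCocycle (hA : IsInjectiveMPS A) (hv : IsVirtualRep A U b v ω) (j : ℕ) :
    IsTwoCocycle (ω j) :=
  have := hA.nonempty_bond
  (hv.isProjectiveRep j).isTwoCocycle

theorem IsVirtualRep.isTwoCoboundary_zpow (hA : IsInjectiveMPS A) (hv : IsVirtualRep A U b v ω)
    (j : ℕ) : IsTwoCoboundary fun g h => ω j g h ^ (b ^ 2 - 1) :=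
  ((hv.isTwoCocycle hA j).cohomologous_comp_zpow_iff b).1 (hv.cohomologous_comp_zpow hA j)

theorem exponential_symmetry_constraint (hA : IsInjectiveMPS A) {L : ℕ} (hL : 0 < L)
    (hS : HasExpSymmetry A U b L) :
    (∃ (v : ℕ → G → Matrix.unitaryGroup (Fin χ) ℂ) (ω : ℕ → G → G → Circle),
        IsVirtualRep A U b v ω) ∧
      ∀ (v : ℕ → G → Matrix.unitaryGroup (Fin χ) ℂ) (ω : ℕ → G → G → Circle),
        IsVirtualRep A U b v ω →
        (∀ (j : ℕ) (g : G), ∃ θ : Circle,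
          (v (j + 1) g : Matrix (Fin χ) (Fin χ) ℂ) =
            (θ : ℂ) • (v j (g ^ b) : Matrix (Fin χ) (Fin χ) ℂ)) ∧
        (∀ (v' : ℕ → G → Matrix.unitaryGroup (Fin χ) ℂ) (ω' : ℕ → G → G → Circle),
          IsVirtualRep A U b v' ω' → ∀ i j : ℕ, Cohomologous (ω i) (ω' j)) ∧
        ∀ j : ℕ,
          IsTwoCocycle (ω j) ∧
          Cohomologous (ω j) (fun g h => ω j (g ^ b) (h ^ b)) ∧
          Cohomologous (fun g h => ω j (g ^ b) (h ^ b)) (fun g h => ω j g h ^ (b ^ 2)) ∧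
          IsTwoCoboundary (fun g h => ω j g h ^ (b ^ 2 - 1)) := by
  have := hA.nonempty_bond
  refine ⟨hA.exists_isVirtualRep hL hS, fun v ω hv => ⟨hv.phaseEq_succ hA,
    fun v' ω' hv' i j => ?_, fun j => ⟨hv.isTwoCocycle hA j, hv.cohomologous_comp_zpow hA j,
      (hv.isTwoCocycle hA j).cohomologous_comp_zpow b, hv.isTwoCoboundary_zpow hA j⟩⟩⟩
  exact (hv.cohomologous hA i j).trans ((hv.isProjectiveRep j).cohomologous_of_phaseEq
    (hv'.isProjectiveRep j) (hv.phaseEq hA hv' j))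

end Symmetry

/-! ### Realization of invariant classes -/

section Eigenstates

variable {d χ : ℕ}

theorem prod_ofFn_gauge (n : ℕ) (v : ℕ → Matrix.unitaryGroup (Fin χ) ℂ)
    (M : Fin n → Matrix (Fin χ) (Fin χ) ℂ) :
    (List.ofFn fun i : Fin n => (v i : Matrix (Fin χ) (Fin χ) ℂ)ᴴ * M i *
        (v (i + 1) : Matrix (Fin χ) (Fin χ) ℂ)).prod =
      (v 0 : Matrix (Fin χ) (Fin χ) ℂ)ᴴ * (List.ofFn M).prod *
        (v n : Matrix (Fin χ) (Fin χ) ℂ) := by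
  induction n generalizing v with
  | zero =>
    simp only [List.ofFn_zero, List.prod_nil, mul_one]
    exact (Matrix.mem_unitaryGroup_iff'.1 (v 0).2).symm
  | succ n ih =>
    have hv : (v 1 : Matrix (Fin χ) (Fin χ) ℂ) * (v 1 : Matrix (Fin χ) (Fin χ) ℂ)ᴴ = 1 :=
      Matrix.mem_unitaryGroup_iff.1 (v 1).2
    have htail := ih (fun j => v (j + 1)) fun i => M i.succ
    simp only [List.ofFn_succ, List.prod_cons, Fin.val_succ, Fin.val_zero, zero_add] at htail ⊢
    rw [htail]
    simp only [← Matrix.mul_assoc]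
    rw [Matrix.mul_assoc _ (v 1 : Matrix (Fin χ) (Fin χ) ℂ), hv, mul_one]

theorem phaseEq_mpsState_of_bondAct {A : MPSTensor d χ} (n : ℕ)
    (W : ℕ → Matrix (Fin d) (Fin d) ℂ) (v : ℕ → Matrix.unitaryGroup (Fin χ) ℂ) (hv : v n = v 0)
    (h : ∀ j, PhaseEq (physAct (W j) A) (bondAct (v j) (v (j + 1)) A)) :
    PhaseEq (siteTensor n W *ᵥ mpsState A n) (mpsState A n) := by
  choose φ hφ using h
  have hv₀ : (v 0 : Matrix (Fin χ) (Fin χ) ℂ) * (v 0 : Matrix (Fin χ) (Fin χ) ℂ)ᴴ = 1 :=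
    Matrix.mem_unitaryGroup_iff.1 (v 0).2
  have hprod : ((∏ i : Fin n, φ i : Circle) : ℂ) = ∏ i : Fin n, (φ i : ℂ) :=
    map_prod Circle.coeHom _ _
  refine ⟨∏ i : Fin n, φ i, ?_⟩
  rw [siteTensor_mulVec_mpsState, hprod]
  ext s
  simp only [chainState, hφ, Pi.smul_apply, bondAct]
  rw [prod_ofFn_smul, prod_ofFn_gauge, hv, Matrix.trace_smul, Matrix.trace_mul_comm,
    ← Matrix.mul_assoc, hv₀, one_mul]
  rfl

theorem IsVirtualRep.hasExpSymmetry {G : Type*} [CommGroup G] {A : MPSTensor d χ}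
    {U : G →* Matrix.unitaryGroup (Fin d) ℂ} {b : ℤ} {L : ℕ}
    {v : ℕ → G → Matrix.unitaryGroup (Fin χ) ℂ} {ω : ℕ → G → G → Circle}
    (hv : IsVirtualRep A U b v ω) (hvL : Function.Periodic v L)
    (hU : ∀ g, U g ^ (b ^ L) = U g) : HasExpSymmetry A U b L where
  periodic := hU
  eigenstate k _ g := phaseEq_mpsState_of_bondAct (k * L) (onSite U b g) (v · g)
    (congrFun (hvL.nat_mul_eq k) g) (hv.phaseEq_physAct · g)

end Eigenstates

section RankOne

variable {n : Type*} [Fintype n] [DecidableEq n] {x y : n → ℂ}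

theorem eigenspace_one_vecMulVec (hyx : y ⬝ᵥ x = 1) :
    End.eigenspace (Matrix.toLin' (Matrix.vecMulVec x y)) 1 = ℂ ∙ x := by
  ext z
  rw [End.mem_eigenspace_iff, Matrix.toLin'_apply, Matrix.vecMulVec_mulVec, op_smul_eq_smul,
    one_smul, Submodule.mem_span_singleton]
  refine ⟨fun h => ⟨_, h⟩, ?_⟩
  rintro ⟨c, rfl⟩
  rw [dotProduct_smul, hyx, smul_eq_mul, mul_one]

theorem eq_zero_of_hasEigenvalue_vecMulVec (hyx : y ⬝ᵥ x = 1) {μ : ℂ}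
    (hμ : End.HasEigenvalue (Matrix.toLin' (Matrix.vecMulVec x y)) μ) (hμ1 : μ ≠ 1) : μ = 0 := by
  obtain ⟨z, hz, hz0⟩ := hμ.exists_hasEigenvector
  rw [End.mem_eigenspace_iff, Matrix.toLin'_apply, Matrix.vecMulVec_mulVec,
    op_smul_eq_smul] at hz
  have hyz : y ⬝ᵥ z = μ * (y ⬝ᵥ z) := by
    simpa only [dotProduct_smul, hyx, smul_eq_mul, mul_one] using congrArg (y ⬝ᵥ ·) hz
  have hyz0 : y ⬝ᵥ z = 0 := by
    by_contra h
    exact hμ1 (mul_right_cancel₀ h (hyz.symm.trans (one_mul _).symm))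
  rw [hyz0, zero_smul] at hz
  exact (smul_eq_zero.1 hz.symm).resolve_right hz0

end RankOne

section PairTensor

/-- The fixed-point tensor, whose physical leg is a pair of virtual legs: `Aⁱʲ = |i⟩⟨j| / √n`. -/
def pairTensor (n : ℕ) : MPSTensor (n * n) n := fun s =>
  Matrix.single (finProdFinEquiv.symm s).1 (finProdFinEquiv.symm s).2 ((√n : ℝ) : ℂ)⁻¹

variable {n : ℕ}

theorem sum_finProdFinEquiv_symm {M : Type*} [AddCommMonoid M] (f : Fin n × Fin n → M) :
    ∑ s : Fin (n * n), f (finProdFinEquiv.symm s) = ∑ i, ∑ j, f (i, j) := by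
  rw [finProdFinEquiv.symm.sum_comp, Fintype.sum_prod_type]

theorem inv_sqrt_mul_inv_sqrt (n : ℕ) :
    ((√n : ℝ) : ℂ)⁻¹ * ((√n : ℝ) : ℂ)⁻¹ = (n : ℂ)⁻¹ := by
  rw [← mul_inv, ← Complex.ofReal_mul, Real.mul_self_sqrt n.cast_nonneg, Complex.ofReal_natCast]

theorem star_inv_sqrt (n : ℕ) : star ((√n : ℝ) : ℂ)⁻¹ = ((√n : ℝ) : ℂ)⁻¹ := by
  rw [star_inv₀, Complex.star_def, Complex.conj_ofReal]

theorem sum_pairTensor_mul_mul_conjTranspose (X : Matrix (Fin n) (Fin n) ℂ) :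
    ∑ s, pairTensor n s * X * (pairTensor n s)ᴴ = ((n : ℂ)⁻¹ * X.trace) • 1 := by
  simp only [pairTensor, Matrix.conjTranspose_single, Matrix.single_mul_mul_single, star_inv_sqrt]
  rw [sum_finProdFinEquiv_symm fun p =>
    Matrix.single p.1 p.1 (((√n : ℝ) : ℂ)⁻¹ * X p.2 p.2 * ((√n : ℝ) : ℂ)⁻¹)]
  simp only [mul_right_comm _ (X _ _), inv_sqrt_mul_inv_sqrt, Matrix.trace, Matrix.diag_apply]
  rw [Finset.sum_comm]
  simp only [Matrix.sum_single_eq_diagonal, ← Matrix.smul_one_eq_diagonal, ← Finset.sum_smul,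
    Finset.mul_sum]

theorem sum_conjTranspose_pairTensor_mul [NeZero n] :
    ∑ s, (pairTensor n s)ᴴ * pairTensor n s = 1 := by
  simp only [pairTensor, Matrix.conjTranspose_single, Matrix.single_mul_single_same, star_inv_sqrt,
    inv_sqrt_mul_inv_sqrt]
  rw [sum_finProdFinEquiv_symm fun p => Matrix.single p.2 p.2 (n : ℂ)⁻¹, Finset.sum_comm]
  simp only [Finset.sum_const, Finset.card_univ, Fintype.card_fin]
  rw [← Finset.smul_sum, Matrix.sum_single_eq_diagonal fun _ => (n : ℂ)⁻¹,
    ← Matrix.smul_one_eq_diagonal, ← Nat.cast_smul_eq_nsmul ℂ, smul_smul,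
    mul_inv_cancel₀ (NeZero.ne _), one_smul]

theorem transferMatrix_pairTensor (n : ℕ) :
    transferMatrix (pairTensor n) =
      Matrix.vecMulVec (Matrix.vec 1) ((n : ℂ)⁻¹ • Matrix.vec 1) := by
  refine Matrix.ext_iff_mulVec.2 fun x => ?_
  obtain ⟨X, rfl⟩ := Matrix.vec_bijective.2 x
  have h := transferMatrix_mulVec_vec (pairTensor n) Xᵀ
  rw [Matrix.transpose_transpose, sum_pairTensor_mul_mul_conjTranspose] at h
  rw [h, Matrix.vecMulVec_mulVec, smul_dotProduct, Matrix.vec_dotProduct_vec, op_smul_eq_smul,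
    Matrix.trace_transpose, Matrix.transpose_smul, Matrix.transpose_one, one_mul, smul_eq_mul,
    Matrix.vec_smul]

theorem isInjectiveMPS_pairTensor (n : ℕ) [NeZero n] : IsInjectiveMPS (pairTensor n) := by
  have hn : (n : ℂ)⁻¹ * n = 1 := inv_mul_cancel₀ (NeZero.ne _)
  have hvec : ((n : ℂ)⁻¹ • Matrix.vec (1 : Matrix (Fin n) (Fin n) ℂ)) ⬝ᵥ Matrix.vec 1 = 1 := by
    rw [smul_dotProduct, Matrix.vec_dotProduct_vec, Matrix.transpose_one, one_mul,
      Matrix.trace_one, Fintype.card_fin, smul_eq_mul, hn]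
  have hvec_ne : Matrix.vec (1 : Matrix (Fin n) (Fin n) ℂ) ≠ 0 := by
    intro h
    rw [h, dotProduct_zero] at hvec
    exact zero_ne_one hvec
  exact {
    left_canonical := sum_conjTranspose_pairTensor_mul
    right_canonical := ⟨1, Matrix.PosDef.one, by
      rw [sum_pairTensor_mul_mul_conjTranspose, Matrix.trace_one, Fintype.card_fin, hn, one_smul]⟩
    unique_dominant := by
      rw [transferMatrix_pairTensor, eigenspace_one_vecMulVec hvec, finrank_span_singleton hvec_ne]
    gap := fun μ hμ hμ1 => by
      rw [transferMatrix_pairTensor] at hμ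
      rw [eq_zero_of_hasEigenvalue_vecMulVec hvec hμ hμ1, norm_zero]
      exact zero_lt_one }

end PairTensor

section PairUnitary

variable {m n : Type*} [Fintype m] [DecidableEq m] [Fintype n] [DecidableEq n]

/-- Relabelling the basis of a unitary matrix. -/
def reindexUnitary (e : m ≃ n) (V : Matrix.unitaryGroup m ℂ) : Matrix.unitaryGroup n ℂ :=
  ⟨Matrix.reindex e e V, Matrix.mem_unitaryGroup_iff.2 <| by
    rw [Matrix.star_eq_conjTranspose, Matrix.conjTranspose_reindex, Matrix.reindex_apply,
      Matrix.reindex_apply, Matrix.submatrix_mul_equiv, ← Matrix.star_eq_conjTranspose,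
      Matrix.mem_unitaryGroup_iff.1 V.2, Matrix.submatrix_one_equiv]⟩

/-- The unitary `V̄ ⊗ V'` on the physical leg of `pairTensor`. -/
def pairUnitary {n : ℕ} (V V' : Matrix.unitaryGroup (Fin n) ℂ) :
    Matrix.unitaryGroup (Fin (n * n)) ℂ :=
  reindexUnitary finProdFinEquiv
    ⟨_, Matrix.kronecker_mem_unitary (Matrix.UnitaryGroup.map_star V).2 V'.2⟩

theorem pairUnitary_apply {n : ℕ} (V V' : Matrix.unitaryGroup (Fin n) ℂ) (s t : Fin (n * n)) :
    (pairUnitary V V' : Matrix (Fin (n * n)) (Fin (n * n)) ℂ) s t =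
      star (V (finProdFinEquiv.symm s).1 (finProdFinEquiv.symm t).1) *
        V' (finProdFinEquiv.symm s).2 (finProdFinEquiv.symm t).2 :=
  rfl

theorem physAct_smul {d χ : ℕ} (c : ℂ) (W : Matrix (Fin d) (Fin d) ℂ) (A : MPSTensor d χ) :
    physAct (c • W) A = c • physAct W A := by
  funext s
  simp only [physAct, Matrix.smul_apply, Pi.smul_apply, smul_assoc, Finset.smul_sum]

theorem physAct_pairUnitary {n : ℕ} (V V' : Matrix.unitaryGroup (Fin n) ℂ) :
    physAct (pairUnitary V V' : Matrix (Fin (n * n)) (Fin (n * n)) ℂ) (pairTensor n) =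
      bondAct V V' (pairTensor n) := by
  funext s
  simp only [physAct, pairTensor, bondAct, pairUnitary_apply]
  rw [sum_finProdFinEquiv_symm fun p => (star (V (finProdFinEquiv.symm s).1 p.1) *
    V' (finProdFinEquiv.symm s).2 p.2) • Matrix.single p.1 p.2 ((√n : ℝ) : ℂ)⁻¹]
  ext k l
  simpa [Matrix.sum_apply, Matrix.single_apply, Matrix.mul_apply, ite_and]
    using mul_right_comm _ _ _

theorem isDiag_of_phaseEq_pairUnitary {n : ℕ} {V V' : Matrix.unitaryGroup (Fin n) ℂ}
    (h : PhaseEq 1 (pairUnitary V V' : Matrix (Fin (n * n)) (Fin (n * n)) ℂ)) :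
    (V : Matrix (Fin n) (Fin n) ℂ).IsDiag := by
  intro i k hik
  have : Nonempty (Fin n) := ⟨i⟩
  obtain ⟨j, l, hjl⟩ : ∃ j l, (V' : Matrix (Fin n) (Fin n) ℂ) j l ≠ 0 := by
    by_contra! h0
    exact coe_unitaryGroup_ne_zero V' (Matrix.ext h0)
  obtain ⟨θ, hθ⟩ := h
  have hentry := congrFun₂ hθ (finProdFinEquiv (i, j)) (finProdFinEquiv (k, l))
  rw [Matrix.one_apply_ne (fun h => hik (congrArg Prod.fst (finProdFinEquiv.injective h))),
    Matrix.smul_apply, pairUnitary_apply] at hentry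
  simpa [hjl] using hentry.symm

variable {G : Type*} [CommGroup G] {ω ω' : G → G → Circle}

theorem IsProjectiveRep.reindex {V : G → Matrix.unitaryGroup m ℂ}
    (hV : IsProjectiveRep V ω) (e : m ≃ n) :
    IsProjectiveRep (fun g => reindexUnitary e (V g)) ω := fun g h => by
  simp only [reindexUnitary, Matrix.reindex_apply]
  rw [Matrix.submatrix_mul_equiv, hV, Matrix.submatrix_smul]
  rfl

theorem IsProjectiveRep.map_star {V : G → Matrix.unitaryGroup n ℂ} (hV : IsProjectiveRep V ω) :
    IsProjectiveRep (fun g => Matrix.UnitaryGroup.map_star (V g)) fun g h => (ω g h)⁻¹ := by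
  intro g h
  have hconj := congrArg (starRingEnd ℂ).mapMatrix (hV g h)
  rw [map_mul] at hconj
  refine hconj.trans (Matrix.ext fun i j => ?_)
  rw [Circle.coe_inv_eq_conj]
  exact map_mul (starRingEnd ℂ) _ _

theorem IsProjectiveRep.pair {n : ℕ} {V V' : G → Matrix.unitaryGroup (Fin n) ℂ}
    (hV : IsProjectiveRep V ω) (hV' : IsProjectiveRep V' ω') :
    IsProjectiveRep (fun g => pairUnitary (V g) (V' g)) fun g h => ω' g h / ω g h := by
  refine IsProjectiveRep.reindex (V := fun g => ⟨_, _⟩) (fun g h => ?_) _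
  change (_ ⊗ₖ _) * (_ ⊗ₖ _) = _ • (_ ⊗ₖ _)
  rw [← Matrix.mul_kronecker_mul, hV.map_star g h, hV', Matrix.smul_kronecker,
    Matrix.kronecker_smul, smul_smul, ← Circle.coe_mul, inv_mul_eq_div]

theorem circle_mem_unitary (c : Circle) : (c : ℂ) ∈ unitary ℂ := by
  rw [Unitary.mem_iff_star_mul_self, Complex.star_def, ← Circle.coe_inv_eq_conj, Circle.coe_inv,
    inv_mul_cancel₀ c.coe_ne_zero]

theorem IsProjectiveRep.exists_monoidHom {V : G → Matrix.unitaryGroup n ℂ}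
    (hV : IsProjectiveRep V ω) (hω : IsTwoCoboundary ω) :
    ∃ U : G →* Matrix.unitaryGroup n ℂ,
      ∀ g, PhaseEq (U g : Matrix n n ℂ) (V g : Matrix n n ℂ) := by
  obtain ⟨β, hβ⟩ := hω
  let U (g : G) : Matrix.unitaryGroup n ℂ :=
    ⟨((β g)⁻¹ : Circle) • (V g : Matrix n n ℂ),
      Unitary.smul_mem_of_mem (R := ℂ) (circle_mem_unitary _) (V g).2⟩
  refine ⟨MonoidHom.mk' U fun g h => Subtype.ext ?_, fun g => ⟨(β g)⁻¹, rfl⟩⟩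
  change (β (g * h))⁻¹ • (V (g * h) : Matrix n n ℂ) =
    ((β g)⁻¹ • (V g : Matrix n n ℂ)) * ((β h)⁻¹ • (V h : Matrix n n ℂ))
  rw [smul_mul_smul_comm, hV, ← Circle.smul_def, hβ, smul_smul]
  rw [← mul_inv, inv_mul_eq_div, div_div_cancel_left]

end PairUnitary

section TwistedRegular

variable {G : Type*} [CommGroup G] [DecidableEq G]

/-- The regular representation twisted by `ω`. -/
def twistedRegular (ω : G → G → Circle) (g : G) : Matrix G G ℂ :=
  Matrix.of fun x y => if x = g * y then (ω g y : ℂ) else 0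

theorem eq_one_of_isDiag_twistedRegular {ω : G → G → Circle} {g : G}
    (h : (twistedRegular ω g).IsDiag) : g = 1 := by
  by_contra hg
  have h1 := h hg
  simp [twistedRegular] at h1

variable [Fintype G]

theorem twistedRegular_mem_unitaryGroup (ω : G → G → Circle) (g : G) :
    twistedRegular ω g ∈ Matrix.unitaryGroup G ℂ := by
  rw [Matrix.mem_unitaryGroup_iff', Matrix.star_eq_conjTranspose]
  ext x y
  simp only [twistedRegular, Matrix.mul_apply, Matrix.conjTranspose_apply, Matrix.of_apply,
    mul_ite, mul_zero, Finset.sum_ite_eq', Finset.mem_univ, if_true, mul_right_inj,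
    Matrix.one_apply]
  by_cases hxy : x = y
  · subst hxy
    rw [if_pos rfl, if_pos rfl, Complex.star_def, Complex.conj_mul', Circle.norm_coe]
    norm_num
  · rw [if_neg (Ne.symm hxy), if_neg hxy, star_zero, zero_mul]

theorem isProjectiveRep_twistedRegular {ω : G → G → Circle} (hω : IsTwoCocycle ω) :
    IsProjectiveRep (fun g => ⟨twistedRegular ω g, twistedRegular_mem_unitaryGroup ω g⟩) ω := by
  intro g h
  ext x y
  simp only [twistedRegular, Matrix.mul_apply, Matrix.of_apply, Matrix.smul_apply, smul_eq_mul,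
    mul_ite, mul_zero, Finset.sum_ite_eq', Finset.mem_univ, if_true, mul_assoc g h]
  split_ifs with hxy
  · rw [← Circle.coe_mul, ← Circle.coe_mul, hω g h y, mul_comm]
  · rw [zero_mul]

end TwistedRegular

section Realization

variable {G : Type*} [CommGroup G] {b : ℤ} {L : ℕ} {ω : G → G → Circle}

theorem exists_faithful_isProjectiveRep [Finite G] (hω : IsTwoCocycle ω) :
    ∃ V : G → Matrix.unitaryGroup (Fin (Nat.card G)) ℂ, IsProjectiveRep V ω ∧
      ∀ g, (V g : Matrix (Fin (Nat.card G)) (Fin (Nat.card G)) ℂ).IsDiag → g = 1 := by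
  classical
  have := Fintype.ofFinite G
  refine ⟨_, (isProjectiveRep_twistedRegular hω).reindex (Finite.equivFin G),
    fun g hg => eq_one_of_isDiag_twistedRegular (ω := ω) ?_⟩
  have := hg.submatrix (Finite.equivFin G).injective
  simpa [reindexUnitary] using this

variable {n : ℕ} {V : G → Matrix.unitaryGroup (Fin n) ℂ}
  {U : G →* Matrix.unitaryGroup (Fin (n * n)) ℂ}

theorem IsProjectiveRep.isVirtualRep_pairTensor (hV : IsProjectiveRep V ω)
    (hU : ∀ g, PhaseEq (U g : Matrix (Fin (n * n)) (Fin (n * n)) ℂ)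
      (pairUnitary (V g) (V (g ^ b)))) :
    IsVirtualRep (pairTensor n) U b (fun j g => V (g ^ (b ^ j)))
      fun j g h => ω (g ^ (b ^ j)) (h ^ (b ^ j)) where
  push_through j g := by
    obtain ⟨θ, hθ⟩ := hU (g ^ (b ^ j))
    refine ⟨θ, fun s => ?_⟩
    rw [onSite_eq, hθ, pow_succ, zpow_mul, physAct_smul]
    exact congrFun (congrArg (_ • ·) (physAct_pairUnitary _ _)) s
  projective j := hV.comp_zpow (b ^ j)

theorem exists_mps_of_cocycle [Finite G] (hL : ∀ g : G, g ^ (b ^ L) = g) (hω : IsTwoCocycle ω)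
    (hinv : Cohomologous (fun g h => ω (g ^ b) (h ^ b)) ω) :
    ∃ (d χ : ℕ) (A : MPSTensor d χ) (U : G →* Matrix.unitaryGroup (Fin d) ℂ)
      (v : ℕ → G → Matrix.unitaryGroup (Fin χ) ℂ) (ω' : ℕ → G → G → Circle),
      Function.Injective U ∧ IsInjectiveMPS A ∧ HasExpSymmetry A U b L ∧
        IsVirtualRep A U b v ω' ∧ ω' 0 = ω := by
  have : NeZero (Nat.card G) := ⟨Nat.card_pos.ne'⟩
  obtain ⟨V, hV, hdiag⟩ := exists_faithful_isProjectiveRep hω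
  obtain ⟨U, hU⟩ := (hV.pair (hV.comp_zpow b)).exists_monoidHom hinv
  have hv := hV.isVirtualRep_pairTensor hU
  refine ⟨_, _, pairTensor (Nat.card G), U, _, _, ?_, isInjectiveMPS_pairTensor _,
    hv.hasExpSymmetry (fun j => ?_) fun g => by rw [← map_zpow, hL], hv, ?_⟩
  · refine (injective_iff_map_eq_one U).2 fun g hg =>
      hdiag g (isDiag_of_phaseEq_pairUnitary (V' := V (g ^ b)) ?_)
    have hUg := hU g
    rwa [hg] at hUg
  · funext g
    change V (g ^ b ^ (j + L)) = V (g ^ b ^ j)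
    rw [pow_add, mul_comm, zpow_mul, hL]
  · simp only [pow_zero, zpow_one]

end Realization

/-! ### Classification of the phases -/

section GroupCohomology

open groupCohomology

variable {G : Type} [CommGroup G]

theorem isTwoCocycle_cocycleVal (x : cocycles₂ (u1Rep G)) : IsTwoCocycle (cocycleVal x) := by
  intro g h l
  have hx : x (g * h, l) + x (g, h) = x (h, l) + x (g, h * l) := (mem_cocycles₂_iff _).1 x.2 g h l
  rw [mul_comm]
  exact congrArg (Additive.toMul (α := Circle)) hx

theorem exists_cocycleVal_eq {ω : G → G → Circle} (hω : IsTwoCocycle ω) :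
    ∃ x : cocycles₂ (u1Rep G), cocycleVal x = ω := by
  refine ⟨⟨fun p => Additive.ofMul (ω p.1 p.2), (mem_cocycles₂_iff _).2 fun g h l => ?_⟩, rfl⟩
  exact (add_comm _ _).trans (congrArg (Additive.ofMul (α := Circle)) (hω g h l))

theorem H2π_eq_zero_iff_isTwoCoboundary (x : cocycles₂ (u1Rep G)) :
    H2π (u1Rep G) x = 0 ↔ IsTwoCoboundary (cocycleVal x) := by
  have coboundary_eq (β : G → Circle) (g h : G) :
      β h / β (g * h) * β g = β g * β h / β (g * h) := by
    rw [div_mul_eq_mul_div, mul_comm]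
  rw [H2π_eq_zero_iff]
  constructor
  · rintro ⟨f, hf⟩
    let β : G → Circle := fun g => Additive.toMul (α := Circle) (f g)
    refine ⟨β, fun g h => ?_⟩
    rw [← coboundary_eq]
    exact (congrArg (Additive.toMul (α := Circle)) (congrFun hf (g, h))).symm
  · rintro ⟨β, hβ⟩
    refine ⟨(fun g => Additive.ofMul (β g) : G → Additive Circle), funext fun p => ?_⟩
    exact congrArg (Additive.ofMul (α := Circle))
      ((coboundary_eq β p.1 p.2).trans (hβ p.1 p.2).symm)

theorem H2π_surjective : Function.Surjective (H2π (u1Rep G)) :=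
  (ModuleCat.epi_iff_surjective _).1 inferInstance

theorem zsmul_H2π_eq_zero_iff (n : ℤ) (x : cocycles₂ (u1Rep G)) :
    n • H2π (u1Rep G) x = 0 ↔ IsTwoCoboundary fun g h => cocycleVal x g h ^ n := by
  rw [← map_zsmul, H2π_eq_zero_iff_isTwoCoboundary]
  rfl

theorem zsmul_eq_zero_of_carriesClass {d χ : ℕ} {A : MPSTensor d χ} (hA : IsInjectiveMPS A)
    {U : G →* Matrix.unitaryGroup (Fin d) ℂ} {b : ℤ} {c : H2U1 G} (hc : CarriesClass A U b c) :
    (b ^ 2 - 1) • c = 0 := by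
  obtain ⟨v, ω, x, hv, hx, rfl⟩ := hc
  rw [zsmul_H2π_eq_zero_iff]
  simpa only [hx] using hv.isTwoCoboundary_zpow hA 0

theorem exists_faithful_carriesClass [Finite G] {b : ℤ} {L : ℕ}
    (hper : ∀ g : G, g ^ (b ^ L) = g) {c : H2U1 G} (hc : (b ^ 2 - 1) • c = 0) :
    ∃ (d χ : ℕ) (A : MPSTensor d χ) (U : G →* Matrix.unitaryGroup (Fin d) ℂ),
      Function.Injective U ∧ IsInjectiveMPS A ∧ HasExpSymmetry A U b L ∧ CarriesClass A U b c := by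
  obtain ⟨x, rfl⟩ := H2π_surjective c
  have hx := isTwoCocycle_cocycleVal x
  have hinv : Cohomologous (fun g h => cocycleVal x (g ^ b) (h ^ b)) (cocycleVal x) :=
    ((hx.cohomologous_comp_zpow_iff b).2 ((zsmul_H2π_eq_zero_iff _ x).1 hc)).symm
  obtain ⟨d, χ, A, U, v, ω, hU, hA, hS, hv, hω⟩ := exists_mps_of_cocycle hper hx hinv
  exact ⟨d, χ, A, U, hU, hA, hS, v, ω, x, hv, fun g h => by rw [hω], rfl⟩

theorem mem_sptPhases_iff [Finite G] {b : ℤ} {L : ℕ} (hper : ∀ g : G, g ^ (b ^ L) = g)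
    (c : H2U1 G) : c ∈ sptPhases G b L ↔ (b ^ 2 - 1) • c = 0 := by
  constructor
  · rintro ⟨d, χ, A, U, hA, -, hc⟩
    exact zsmul_eq_zero_of_carriesClass hA hc
  · intro hc
    obtain ⟨d, χ, A, U, -, hA, hS, hcarries⟩ := exists_faithful_carriesClass hper hc
    exact ⟨d, χ, A, U, hA, hS, hcarries⟩

end GroupCohomology

section ZN2

open groupCohomology

variable {N : ℕ}

theorem exists_eq_gen_zpow_mul_gen_zpow (g : ZN2 N) :
    ∃ m n : ℤ, g = gen₁ N ^ m * gen₂ N ^ n := by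
  obtain ⟨m, hm⟩ := ZMod.intCast_surjective (Multiplicative.toAdd g.1)
  obtain ⟨n, hn⟩ := ZMod.intCast_surjective (Multiplicative.toAdd g.2)
  refine ⟨m, n, Prod.ext ?_ ?_⟩ <;> apply Multiplicative.toAdd.injective
  · simp [gen₁, gen₂, ← hm]
  · simp [gen₁, gen₂, ← hn]

theorem zpow_eq_self_of_intCast_eq_one {n : ℤ} (h : (n : ZMod N) = 1) (g : ZN2 N) : g ^ n = g := by
  ext <;> exact Multiplicative.toAdd.injective (by simp [h])

theorem gen₁_zpow_card : gen₁ N ^ (N : ℤ) = 1 := by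
  ext <;> simp [gen₁, ← ofAdd_nsmul]

theorem exists_period [NeZero N] {b : ℤ} (hb : IsCoprime b (N : ℤ)) :
    ∃ L : ℕ, 0 < L ∧ ∀ g : ZN2 N, g ^ (b ^ L) = g := by
  obtain ⟨u, hu⟩ := (ZMod.coe_int_isUnit_iff_isCoprime b N).2 hb.symm
  refine ⟨orderOf u, orderOf_pos u, zpow_eq_self_of_intCast_eq_one ?_⟩
  rw [Int.cast_pow, ← hu, ← Units.val_pow_eq_pow_val, pow_orderOf_eq_one, Units.val_one]

theorem exists_toCircle_eq [NeZero N] {z : Circle} (hz : z ^ N = 1) :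
    ∃ k : ZMod N, ZMod.toCircle k = z := by
  have hroot : Circle.toUnits z ∈ rootsOfUnity N ℂ := by
    rw [mem_rootsOfUnity, ← map_pow, hz, map_one]
  obtain ⟨i, -, hi⟩ := (Complex.mem_rootsOfUnity N _).1 hroot
  refine ⟨(i : ZMod N), Circle.coe_injective ?_⟩
  rw [ZMod.toCircle_natCast, show (z : ℂ) = Circle.toUnits z from rfl, ← hi, ← mul_div_assoc]

theorem cocycleComm_eq_one_of_isTwoCoboundary {G : Type*} [CommGroup G] {ω : G → G → Circle}
    (hω : IsTwoCoboundary ω) (g h : G) : cocycleComm ω g h = 1 := by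
  obtain ⟨β, hβ⟩ := hω
  rw [cocycleComm, hβ, hβ, mul_comm h, mul_comm (β h), div_self']

theorem isTwoCoboundary_of_cocycleComm_gen_eq_one {ω : ZN2 N → ZN2 N → Circle}
    (hω : IsTwoCocycle ω) (h₁₂ : cocycleComm ω (gen₁ N) (gen₂ N) = 1) : IsTwoCoboundary ω := by
  have h₂₁ : cocycleComm ω (gen₂ N) (gen₁ N) = 1 := by rw [← inv_cocycleComm, h₁₂, inv_one]
  refine isTwoCoboundary_of_cocycleComm_eq_one hω fun g k => ?_
  obtain ⟨m, n, rfl⟩ := exists_eq_gen_zpow_mul_gen_zpow g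
  obtain ⟨m', n', rfl⟩ := exists_eq_gen_zpow_mul_gen_zpow k
  simp only [cocycleComm_mul_left hω, cocycleComm_mul_right hω, cocycleComm_zpow_left hω,
    cocycleComm_zpow_right hω, h₁₂, h₂₁, cocycleComm_self, one_zpow, mul_one]

theorem cocycleComm_gen_pow_card {ω : ZN2 N → ZN2 N → Circle} (hω : IsTwoCocycle ω) :
    cocycleComm ω (gen₁ N) (gen₂ N) ^ N = 1 := by
  rw [← zpow_natCast, ← cocycleComm_zpow_left hω, gen₁_zpow_card,
    ← zpow_zero (gen₁ N), cocycleComm_zpow_left hω, zpow_zero]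

theorem exists_cocycle_cocycleComm_gen_eq [NeZero N] (k : ZMod N) :
    ∃ ω : ZN2 N → ZN2 N → Circle, IsTwoCocycle ω ∧
      cocycleComm ω (gen₁ N) (gen₂ N) = ZMod.toCircle k := by
  refine ⟨fun g h => ZMod.toCircle (k * (Multiplicative.toAdd g.1 * Multiplicative.toAdd h.2)),
    fun g h l => ?_, ?_⟩
  · simp only [← AddChar.map_add_eq_mul, Prod.fst_mul, Prod.snd_mul, toAdd_mul]
    congr 1
    ring
  · simp [cocycleComm, gen₁, gen₂]

theorem exists_commutator_hom [NeZero N] :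
    ∃ κ : cocycles₂ (u1Rep (ZN2 N)) →+ ZMod N,
      ∀ x, ZMod.toCircle (κ x) = cocycleComm (cocycleVal x) (gen₁ N) (gen₂ N) := by
  choose κ hκ using fun x : cocycles₂ (u1Rep (ZN2 N)) =>
    exists_toCircle_eq (cocycleComm_gen_pow_card (isTwoCocycle_cocycleVal x))
  refine ⟨AddMonoidHom.mk' κ fun x y => ZMod.injective_toCircle ?_, hκ⟩
  rw [AddChar.map_add_eq_mul, hκ, hκ, hκ]
  exact mul_div_mul_comm _ _ _ _

theorem exists_addEquiv_of_ker_eq {B C D : Type*} [AddGroup B] [AddGroup C] [AddGroup D]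
    {f : B →+ C} {g : B →+ D} (hf : Function.Surjective f) (hg : Function.Surjective g)
    (hker : f.ker = g.ker) : ∃ e : C ≃+ D, ∀ x, e (f x) = g x := by
  let ef := QuotientAddGroup.quotientKerEquivOfSurjective f hf
  let eg := QuotientAddGroup.quotientKerEquivOfSurjective g hg
  refine ⟨ef.symm.trans ((QuotientAddGroup.quotientAddEquivOfEq hker).trans eg), fun x => ?_⟩
  have hx : ef.symm (f x) = (x : B ⧸ f.ker) := ef.symm_apply_apply x
  rw [AddEquiv.trans_apply, hx]
  rfl

theorem exists_label [NeZero N] :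
    ∃ label : H2U1 (ZN2 N) ≃+ ZMod N, ∀ x : cocycles₂ (u1Rep (ZN2 N)),
      ZMod.toCircle (label (H2π (u1Rep (ZN2 N)) x)) =
        cocycleComm (cocycleVal x) (gen₁ N) (gen₂ N) := by
  obtain ⟨κ, hκ⟩ := exists_commutator_hom (N := N)
  let π : cocycles₂ (u1Rep (ZN2 N)) →+ H2U1 (ZN2 N) := (H2π (u1Rep (ZN2 N))).hom.toAddMonoidHom
  have hker : π.ker = κ.ker := by
    ext x
    have hκx : κ x = 0 ↔ cocycleComm (cocycleVal x) (gen₁ N) (gen₂ N) = 1 := by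
      rw [← hκ, ← AddChar.map_zero_eq_one (ZMod.toCircle (N := N)), ZMod.injective_toCircle.eq_iff]
    exact (H2π_eq_zero_iff_isTwoCoboundary x).trans <| .trans
      ⟨fun h => cocycleComm_eq_one_of_isTwoCoboundary h _ _,
        isTwoCoboundary_of_cocycleComm_gen_eq_one (isTwoCocycle_cocycleVal x)⟩ hκx.symm
  have hsurj : Function.Surjective κ := fun k => by
    obtain ⟨ω, hω, hk⟩ := exists_cocycle_cocycleComm_gen_eq k
    obtain ⟨x, rfl⟩ := exists_cocycleVal_eq hω
    exact ⟨x, ZMod.injective_toCircle ((hκ x).trans hk)⟩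
  obtain ⟨label, hlabel⟩ := exists_addEquiv_of_ker_eq (f := π) H2π_surjective hsurj hker
  exact ⟨label, fun x => (congrArg _ (hlabel x)).trans (hκ x)⟩

end ZN2

section Torsion

variable {N : ℕ} {C : Type*} [AddCommGroup C]

theorem intCast_mul_eq_zero_iff_exists [NeZero N] (a : ℤ) (k : ZMod N) :
    (a : ZMod N) * k = 0 ↔ ∃ m : ℤ, k = ((m * ((N / Int.gcd a N : ℕ) : ℤ) : ℤ) : ZMod N) := by
  obtain ⟨z, rfl⟩ := ZMod.intCast_surjective k
  have hN : (Int.gcd a N : ℤ) * (N / Int.gcd a N : ℕ) = N := by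
    exact_mod_cast Nat.mul_div_cancel' (Int.natCast_dvd_natCast.1 (Int.gcd_dvd_right a N))
  generalize ((N / Int.gcd a N : ℕ) : ℤ) = q at hN ⊢
  have hg : (Int.gcd a N : ℤ) ≠ 0 := left_ne_zero_of_mul (hN ▸ Nat.cast_ne_zero.2 (NeZero.ne N))
  have hdvd : (N : ℤ) ∣ a * z ↔ q ∣ z := by
    rw [← dvd_gcd_mul_iff_dvd_mul, ← Int.coe_gcd, Int.gcd_comm]
    nth_rw 1 [← hN]
    exact mul_dvd_mul_iff_left hg
  rw [← Int.cast_mul, ZMod.intCast_zmod_eq_zero_iff_dvd, hdvd]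
  constructor
  · rintro ⟨m, rfl⟩
    exact ⟨m, by rw [mul_comm]⟩
  · rintro ⟨m, hm⟩
    rw [ZMod.intCast_eq_intCast_iff_dvd_sub] at hm
    exact (dvd_sub_right (dvd_mul_left q m)).1 ((Dvd.intro_left _ hN).trans hm)

theorem zsmul_eq_zero_iff_exists [NeZero N] (e : C ≃+ ZMod N) (a : ℤ) (c : C) :
    a • c = 0 ↔ ∃ m : ℤ, e c = ((m * ((N / Int.gcd a N : ℕ) : ℤ) : ℤ) : ZMod N) := by
  rw [← intCast_mul_eq_zero_iff_exists, ← e.map_eq_zero_iff, map_zsmul, zsmul_eq_mul]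

theorem mem_torsionBy_iff_zsmul_eq_zero {a : ℤ} {c : C} :
    c ∈ AddSubgroup.torsionBy C a ↔ a • c = 0 :=
  Submodule.mem_torsionBy_iff a c

theorem nonempty_torsionBy_addEquiv [NeZero N] (e : C ≃+ ZMod N) (a : ℤ) :
    Nonempty (AddSubgroup.torsionBy C a ≃+ ZMod (Int.gcd a N)) := by
  have : Finite C := .of_injective e e.injective
  have : IsAddCyclic C := isAddCyclic_of_surjective e.symm e.symm.surjective
  have hC : Nat.card C = N := (Nat.card_congr e.toEquiv).trans (Nat.card_zmod N)
  have hker : AddSubgroup.torsionBy C a = (nsmulAddMonoidHom a.natAbs : C →+ C).ker := by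
    ext c
    rw [mem_torsionBy_iff_zsmul_eq_zero, AddMonoidHom.mem_ker, nsmulAddMonoidHom_apply,
      natAbs_nsmul_eq_zero]
  have hcard : Nat.card (AddSubgroup.torsionBy C a) = Int.gcd a N := by
    rw [hker, IsAddCyclic.card_nsmulAddMonoidHom_ker, hC, Nat.gcd_comm]
    rfl
  rw [← hcard]
  exact ⟨(zmodAddCyclicAddEquiv inferInstance).symm⟩

end Torsion

end ExpSPT

end

open ExpSPT in
theorem mainTheorem4 :
    -- every symmetric injective MPS has a virtual cocycle, unique up to coboundaries, and it
    -- satisfies the constraint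
    (∀ (G : Type u) [CommGroup G] (b : ℤ) (L : ℕ), 0 < L →
      ∀ (d χ : ℕ) (A : MPSTensor d χ) (U : G →* Matrix.unitaryGroup (Fin d) ℂ),
      IsInjectiveMPS A → HasExpSymmetry A U b L →
      (∃ (v : ℕ → G → Matrix.unitaryGroup (Fin χ) ℂ) (ω : ℕ → G → G → Circle),
        IsVirtualRep A U b v ω) ∧
      ∀ (v : ℕ → G → Matrix.unitaryGroup (Fin χ) ℂ) (ω : ℕ → G → G → Circle),
        IsVirtualRep A U b v ω →
        (∀ (j : ℕ) (g : G), ∃ θ : Circle,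
          (v (j + 1) g : Matrix (Fin χ) (Fin χ) ℂ) =
            (θ : ℂ) • (v j (g ^ b) : Matrix (Fin χ) (Fin χ) ℂ)) ∧
        (∀ (v' : ℕ → G → Matrix.unitaryGroup (Fin χ) ℂ) (ω' : ℕ → G → G → Circle),
          IsVirtualRep A U b v' ω' → ∀ i j : ℕ, Cohomologous (ω i) (ω' j)) ∧
        ∀ j : ℕ,
          IsTwoCocycle (ω j) ∧
          Cohomologous (ω j) (fun g h => ω j (g ^ b) (h ^ b)) ∧
          Cohomologous (fun g h => ω j (g ^ b) (h ^ b)) (fun g h => ω j g h ^ (b ^ 2)) ∧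
          IsTwoCoboundary (fun g h => ω j g h ^ (b ^ 2 - 1))) ∧
    -- the classification for `ℤ_N × ℤ_N`
    (∀ (N : ℕ), 0 < N → ∀ b : ℤ, IsCoprime b (N : ℤ) →
      (∃ L : ℕ, 0 < L ∧ ∀ g : ZN2 N, g ^ (b ^ L) = g) ∧
      ∃ label : H2U1 (ZN2 N) ≃+ ZMod N,
        (∀ (x : groupCohomology.cocycles₂ (u1Rep (ZN2 N))) (k : ℤ),
          label (groupCohomology.H2π (u1Rep (ZN2 N)) x) = (k : ZMod N) ↔
            ((cocycleVal x (gen₁ N) (gen₂ N) / cocycleVal x (gen₂ N) (gen₁ N) : Circle) : ℂ) =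
              Complex.exp (2 * Real.pi * Complex.I * k / N)) ∧
        ∀ L : ℕ, 0 < L → (∀ g : ZN2 N, g ^ (b ^ L) = g) →
          (∀ c : H2U1 (ZN2 N), c ∈ sptPhases (ZN2 N) b L ↔
            ∃ m : ℤ, label c = ((m * ((N / Int.gcd (b ^ 2 - 1) N : ℕ) : ℤ) : ℤ) : ZMod N)) ∧
          (∀ c ∈ sptPhases (ZN2 N) b L,
            ∃ (d χ : ℕ) (A : MPSTensor d χ) (U : ZN2 N →* Matrix.unitaryGroup (Fin d) ℂ),
              Function.Injective U ∧ IsInjectiveMPS A ∧ HasExpSymmetry A U b L ∧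
                CarriesClass A U b c) ∧
          ∃ S : AddSubgroup (H2U1 (ZN2 N)), (S : Set (H2U1 (ZN2 N))) = sptPhases (ZN2 N) b L ∧
            Nonempty (S ≃+ ZMod (Int.gcd (b ^ 2 - 1) N))) := by
  refine ⟨fun G _ b L hL d χ A U hA hS => exponential_symmetry_constraint hA hL hS,
    fun N hN b hb => ?_⟩
  have : NeZero N := ⟨hN.ne'⟩
  obtain ⟨label, hlabel⟩ := exists_label (N := N)
  refine ⟨exists_period hb, label, fun x k => ?_, fun L _ hper => ⟨fun c => ?_, fun c hc => ?_, ?_⟩⟩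
  · rw [← ZMod.toCircle_intCast, Circle.coe_inj, ← ZMod.injective_toCircle.eq_iff, hlabel]
    rfl
  · rw [mem_sptPhases_iff hper, zsmul_eq_zero_iff_exists label]
  · exact exists_faithful_carriesClass hper ((mem_sptPhases_iff hper c).1 hc)
  · exact ⟨AddSubgroup.torsionBy _ (b ^ 2 - 1),
      Set.ext fun c => mem_torsionBy_iff_zsmul_eq_zero.trans (mem_sptPhases_iff hper c).symm,
      nonempty_torsionBy_addEquiv label (b ^ 2 - 1)⟩
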